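/- Let $\mathfrak h$ be a finite-dimensional real Lie algebra with an inner product $h$, i.e. the Lie algebra of a Lie group $H$ with a left-invariant Riemannian metric $h$. Suppose $(H,h)$ is an algebraic Ricci soliton: its Ricci operator is $\mathrm{Ric}_h=\lambda I+D$ with $\lambda\in\mathbb R$ and $D$ a derivation of $\mathfrak h$. Let $m\neq 0$ be a real number. For $\alpha\in\mathbb R$ let $G_\alpha$ be the simply connected Lie group with Lie algebra $\mathbb R\xi\ltimes\mathfrak h$, where $\mathrm{ad}_\xi|_{\mathfrak h}=\alpha D$, and let $g_\alpha$ be the left-invariant metric on $G_\alpha$ that extends $h$ and for which $\xi$ is a unit vector orthogonal to $\mathfrak h$. Call $g_\alpha$ an $m$-quasi-Einstein metric (with constant $\lambda$) if there is a smooth function $w:G_\alpha\to\mathbb R$, not identically zero, with $$\mathrm{Hess}\,w=\frac wm\,(\mathrm{Ric}_{g_\alpha}-\lambda g_\alpha);$$ in the case $D=0$ it is required in addition that $w>0$ everywhere (if $D\ne0$, $w$ may change sign). 1. If $\mathrm{Ric}_h\neq 0$, then there is an $\alpha\in\mathbb R$ such that $g_\alpha$ is $m$-quasi-Einstein with constant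 $\lambda$ and is not an Einstein metric if and only if $\mathrm{tr}\,D>m\lambda$. 2. Without the assumption $\mathrm{Ric}_h\neq0$, there is an $\alpha\in\mathbb R$ such that $g_\alpha$ is $m$-quasi-Einstein with constant $\lambda$ and $\mathrm{Ric}_{g_\alpha}\neq\lambda g_\alpha$ if and only if $\mathrm{tr}\,D>m\lambda$. -/

import Mathlib

open scoped Manifold ContDiff

attribute [local instance 100] LieRing.ofAssociativeRing

noncomputable section

/-! ### Left-invariant Riemannian metrics, described on the Lie algebra -/

/-- An inner product on the finite-dimensional real Lie algebra `𝔤` of a Lie group; by left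
translation this is the same as a left-invariant Riemannian metric on the group. -/
structure InvariantMetric (𝔤 : Type*) [AddCommGroup 𝔤] [Module ℝ 𝔤] where
  form : LinearMap.BilinForm ℝ 𝔤
  symm : ∀ x y, form x y = form y x
  pos : ∀ x, x ≠ 0 → 0 < form x x

namespace InvariantMetric

theorem nondegenerate {𝔤 : Type*} [AddCommGroup 𝔤] [Module ℝ 𝔤]
    (g : InvariantMetric 𝔤) : g.form.Nondegenerate := by
  constructor
  · intro x hx
    by_contra h
    exact (g.pos x h).ne' (hx x)
  · intro x hx
    by_contra h
    exact (g.pos x h).ne' (hx x)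

/-- Transport of a metric along a linear isomorphism. -/
def map {𝔤 𝔤' : Type*} [AddCommGroup 𝔤] [Module ℝ 𝔤] [AddCommGroup 𝔤'] [Module ℝ 𝔤']
    (g : InvariantMetric 𝔤) (e : 𝔤 ≃ₗ[ℝ] 𝔤') : InvariantMetric 𝔤' where
  form := g.form.compl₁₂ (e.symm : 𝔤' →ₗ[ℝ] 𝔤) (e.symm : 𝔤' →ₗ[ℝ] 𝔤)
  symm x y := by simpa using g.symm (e.symm x) (e.symm y)
  pos x hx := by simpa using g.pos (e.symm x) (by simpa using hx)

variable {𝔤 : Type*} [LieRing 𝔤] [LieAlgebra ℝ 𝔤] (g : InvariantMetric 𝔤)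

/-- Right-hand side of the Koszul formula for left-invariant fields, as a functional of `Z`:
`(⟨[X, Y], Z⟩ - ⟨[Y, Z], X⟩ + ⟨[Z, X], Y⟩) / 2`. -/
def koszul (X Y : 𝔤) : Module.Dual ℝ 𝔤 where
  toFun Z := (g.form ⁅X, Y⁆ Z - g.form ⁅Y, Z⁆ X + g.form ⁅Z, X⁆ Y) / 2
  map_add' a b := by simp; ring
  map_smul' c a := by simp; ring

variable [FiniteDimensional ℝ 𝔤]

/-- The Levi-Civita connection on left-invariant fields: `g.nabla X Y` is `∇_X Y`. -/
def nabla : 𝔤 →ₗ[ℝ] 𝔤 →ₗ[ℝ] 𝔤 :=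
  LinearMap.mk₂ ℝ (fun X Y => (g.form.toDual g.nondegenerate).symm (g.koszul X Y))
    (fun a b Y => by
      rw [← map_add]; congr 1; ext Z; simp [koszul]; ring)
    (fun c a Y => by
      rw [← map_smul]; congr 1; ext Z; simp [koszul]; ring)
    (fun X a b => by
      rw [← map_add]; congr 1; ext Z; simp [koszul]; ring)
    (fun c X a => by
      rw [← map_smul]; congr 1; ext Z; simp [koszul]; ring)

/-- The curvature tensor `R(X, Y) Z = ∇_X ∇_Y Z - ∇_Y ∇_X Z - ∇_[X, Y] Z`. -/
def curvature (X Y Z : 𝔤) : 𝔤 :=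
  g.nabla X (g.nabla Y Z) - g.nabla Y (g.nabla X Z) - g.nabla ⁅X, Y⁆ Z

/-- The Ricci tensor `Ric(X, Y) = tr (Z ↦ R(Z, X) Y)`. -/
def ricci (X Y : 𝔤) : ℝ :=
  LinearMap.trace ℝ 𝔤
    { toFun := fun Z => g.curvature Z X Y
      map_add' := fun a b => by simp [curvature]; abel
      map_smul' := fun c a => by simp [curvature, smul_sub] }

/-- `Ric = mu • g`. -/
def IsEinsteinWith (mu : ℝ) : Prop :=
  ∀ X Y : 𝔤, g.ricci X Y = mu * g.form X Y

/-- `g` is an Einstein metric. -/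
def IsEinstein : Prop :=
  ∃ mu : ℝ, g.IsEinsteinWith mu

/-- Algebraic Ricci soliton: the Ricci operator is `lam • I + D` with `D` a derivation. -/
def IsAlgebraicRicciSoliton (lam : ℝ) (D : LieDerivation ℝ 𝔤 𝔤) : Prop :=
  ∀ X Y : 𝔤, g.ricci X Y = g.form (lam • X + D X) Y

end InvariantMetric

/-! ### The one-dimensional extension `ℝξ ⋉ 𝔥` with `ad ξ = α D` on `𝔥` -/

section Extension

variable {𝔥 : Type*} [LieRing 𝔥] [LieAlgebra ℝ 𝔥]

/-- The action `t ↦ t • D` of the abelian Lie algebra `ℝ` through multiples of `D`. -/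
def lineAction (D : LieDerivation ℝ 𝔥 𝔥) : ℝ →ₗ⁅ℝ⁆ LieDerivation ℝ 𝔥 𝔥 where
  toFun t := t • D
  map_add' s t := add_smul s t D
  map_smul' s t := by simp [mul_smul]
  map_lie' := by
    intro s t
    ext x
    simp [LieRing.of_associative_ring_bracket, mul_comm]

/-- The Lie algebra `ℝξ ⋉ 𝔥` in which `[ξ, X] = α D X` for `X ∈ 𝔥`. An element `⟨X, t⟩` stands
for `X + t ξ`. -/
abbrev LineExtension (D : LieDerivation ℝ 𝔥 𝔥) (α : ℝ) : Type _ :=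
  LieAlgebra.SemiDirectSum 𝔥 ℝ (lineAction (α • D))

/-- The inner product on `ℝξ ⋉ 𝔥` extending `h`, with `ξ` a unit vector orthogonal to `𝔥`. -/
def InvariantMetric.extend (h : InvariantMetric 𝔥) (D : LieDerivation ℝ 𝔥 𝔥) (α : ℝ) :
    InvariantMetric (LineExtension D α) where
  form := LinearMap.mk₂ ℝ (fun x y => h.form x.left y.left + x.right * y.right)
    (fun a b y => by simp; ring)
    (fun c a y => by simp; ring)
    (fun x a b => by simp; ring)
    (fun c x a => by simp; ring)
  symm x y := by simp [h.symm x.left y.left, mul_comm]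
  pos x hx := by
    obtain ⟨X, t⟩ := x
    by_cases hX : X = 0
    · have ht : t ≠ 0 := by
        rintro rfl
        exact hx (by rw [hX]; rfl)
      simpa [hX] using ht
    · have := h.pos X hX
      simp only [LinearMap.mk₂_apply]
      nlinarith [mul_self_nonneg t]

end Extension

/-! ### Functions on a Lie group with a left-invariant metric -/

section Group

variable {E : Type*} [NormedAddCommGroup E] [NormedSpace ℝ E] [FiniteDimensional ℝ E]
  {G : Type*} [Group G] [TopologicalSpace G] [ChartedSpace E G]

/-- A smooth Lie group is a Lie group of the regularity required for its Lie algebra. -/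
instance lieGroupMinSmoothness [LieGroup 𝓘(ℝ, E) ∞ G] :
    LieGroup 𝓘(ℝ, E) (minSmoothness ℝ 3) G :=
  LieGroup.of_le (n := ∞) (by
    rw [minSmoothness_of_isRCLikeNormedField]
    exact WithTop.coe_le_coe.2 le_top)

instance completeSpaceModel : CompleteSpace E := FiniteDimensional.complete ℝ E

instance finiteDimensionalGroupLieAlgebra :
    FiniteDimensional ℝ (GroupLieAlgebra 𝓘(ℝ, E) G) :=
  inferInstanceAs (FiniteDimensional ℝ E)

/-- The derivative of `f` along the left-invariant vector field determined by `X`. -/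
def leftDeriv (X : GroupLieAlgebra 𝓘(ℝ, E) G) (f : G → ℝ) (p : G) : ℝ :=
  mfderiv 𝓘(ℝ, E) 𝓘(ℝ, ℝ) f p (mulInvariantVectorField X p)

variable [LieGroup 𝓘(ℝ, E) ∞ G]

/-- The Hessian of `w` on left-invariant fields, `Hess w (X, Y) = X (Y w) - (∇_X Y) w`. Since
left-invariant fields form a global frame, these values determine the Hessian. -/
def hessian (g : InvariantMetric (GroupLieAlgebra 𝓘(ℝ, E) G)) (w : G → ℝ)
    (X Y : GroupLieAlgebra 𝓘(ℝ, E) G) (p : G) : ℝ :=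
  leftDeriv X (leftDeriv Y w) p - leftDeriv (g.nabla X Y) w p

/-- `w` is a smooth, not identically zero solution of the `m`-quasi-Einstein equation
`Hess w = (w / m) (Ric - lam g)`. -/
structure IsQuasiEinstein (g : InvariantMetric (GroupLieAlgebra 𝓘(ℝ, E) G)) (m lam : ℝ)
    (w : G → ℝ) : Prop where
  smooth : ContMDiff 𝓘(ℝ, E) 𝓘(ℝ, ℝ) ∞ w
  nontrivial : ∃ p, w p ≠ 0
  equation : ∀ (X Y : GroupLieAlgebra 𝓘(ℝ, E) G) (p : G),
    hessian g w X Y p = w p / m * (g.ricci X Y - lam * g.form X Y)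

end Group

end

/-! Write `T` for the trace of `D`. The algebraic core is a pair of soliton identities: `tr (D ∘ ad
X) = 0` and `tr D² = -lam T` (`trace_comp_ad`, `trace_sq`). Both come from pairing the Ricci
operator with a derivation (`sum_ricci_derivation`). As `D` is self-adjoint, `lam T = 0` forces `D =
0`.

With these identities the extension satisfies `Ric - lam g = (1 - α² T)(⟨D·,·⟩ - lam ξ* ⊗ ξ*)`
(`extend_ricci`), so the deviation from Einstein is a scalar multiple of a fixed form.

Necessity: put `κ = (1 - α² T)/m`. Commuting third derivatives of `w` and tracing over `𝔥` gives
`(ξw) T (κ + lam α²) = 0` (`leftDeriv_xi_eq`). If `D ≠ 0`, then `ξw = 0` is incompatible with `ξξw =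
-κ lam w`, so `κ = -lam α²`, that is `α² (T - m lam) = 1`, and `T > m lam`. If `D = 0`, the equation
along an integral curve of `ξ` is `f'' = -(lam/m) f`, which has a positive solution on the whole
line only if `m lam ≤ 0`.

Sufficiency: take `α² (T - m lam) = 1` and `w = exp (lam α f)`, where `f` is a function with `ξf =
1` that is constant along `𝔥`. It exists because the dual form of `ξ` kills brackets and the group
is simply connected (`exists_primitive`). If `Ric_h ≠ 0`, an extension that is not Einstein with
constant `lam` is not Einstein at all (`not_isEinstein_extend`). -/

noncomputable section

namespace InvariantMetric

/-! ### Traces of skew and self-adjoint operators. -/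

section Linear

variable {V : Type*} [AddCommGroup V] [Module ℝ V] (g : InvariantMetric V)

theorem eq_of_forall_form_eq {x y : V} (h : ∀ z, g.form x z = g.form y z) : x = y := by
  rw [← sub_eq_zero]
  by_contra hne
  have := g.pos _ hne
  rw [LinearMap.map_sub₂, h, sub_self] at this
  exact this.false

section Orthonormal

variable {g} {ι : Type*} [Fintype ι] [DecidableEq ι] {b : Module.Basis ι ℝ V}

theorem repr_eq_form (hb : ∀ i j, g.form (b i) (b j) = if i = j then 1 else 0) (x : V) (k : ι) :
    b.repr x k = g.form x (b k) := by
  have h := congrArg (fun y => g.form y (b k)) (b.sum_repr x)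
  simp only [map_sum, map_smul, LinearMap.sum_apply, LinearMap.smul_apply, hb] at h
  simpa using h

theorem trace_eq_sum_form (hb : ∀ i j, g.form (b i) (b j) = if i = j then 1 else 0)
    (A : V →ₗ[ℝ] V) : LinearMap.trace ℝ V A = ∑ i, g.form (A (b i)) (b i) := by
  rw [LinearMap.trace_eq_matrix_trace ℝ b, Matrix.trace]
  refine Finset.sum_congr rfl fun i _ => ?_
  rw [Matrix.diag_apply, LinearMap.toMatrix_apply, repr_eq_form hb]

end Orthonormal

variable [FiniteDimensional ℝ V]

theorem exists_orthonormal_basis :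
    ∃ b : Module.Basis (Fin (Module.finrank ℝ V)) ℝ V,
      ∀ i j, g.form (b i) (b j) = if i = j then 1 else 0 := by
  let c : InnerProductSpace.Core ℝ V :=
    { inner := fun x y => g.form x y
      conj_inner_symm := fun x y => by simpa using g.symm y x
      re_inner_nonneg := fun x => by
        by_cases hx : x = 0
        · simp [hx]
        · exact (g.pos x hx).le
      add_left := fun x y z => by simp
      smul_left := fun x y r => by simp
      definite := fun x hx => by
        by_contra h
        exact (g.pos x h).ne' hx }
  let := c.toNormedAddCommGroup
  let : InnerProductSpace ℝ V := InnerProductSpace.ofCore c.toCore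
  let b := stdOrthonormalBasis ℝ V
  refine ⟨b.toBasis, fun i j => ?_⟩
  have := orthonormal_iff_ite.1 b.orthonormal i j
  rw [OrthonormalBasis.coe_toBasis]
  exact this

theorem trace_eq_of_adjoint {A B : V →ₗ[ℝ] V} (h : ∀ x y, g.form (A x) y = g.form x (B y)) :
    LinearMap.trace ℝ V A = LinearMap.trace ℝ V B := by
  obtain ⟨b, hb⟩ := g.exists_orthonormal_basis
  rw [trace_eq_sum_form hb, trace_eq_sum_form hb]
  exact Finset.sum_congr rfl fun i _ => by rw [h, g.symm]

theorem trace_skew {S : V →ₗ[ℝ] V} (hS : ∀ x y, g.form (S x) y = -g.form x (S y)) :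
    LinearMap.trace ℝ V S = 0 := by
  have := g.trace_eq_of_adjoint (A := S) (B := -S) (by simpa using hS)
  rw [map_neg] at this
  linarith

/-- The adjoint of `S T` is `-T S`, which has the opposite trace by cyclicity. -/
theorem trace_skew_comp_symm {S T : V →ₗ[ℝ] V} (hS : ∀ x y, g.form (S x) y = -g.form x (S y))
    (hT : ∀ x y, g.form (T x) y = g.form x (T y)) :
    LinearMap.trace ℝ V (S ∘ₗ T) = 0 := by
  have := g.trace_eq_of_adjoint (A := S ∘ₗ T) (B := -(T ∘ₗ S)) (by simp [hS, hT])
  rw [map_neg, LinearMap.trace_comp_comm' S T] at this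
  linarith

end Linear

section Lie

variable {𝔤 : Type*} [LieRing 𝔤] [LieAlgebra ℝ 𝔤]

theorem trace_ad_lie (X Y : 𝔤) : LinearMap.trace ℝ 𝔤 (LieAlgebra.ad ℝ 𝔤 ⁅X, Y⁆) = 0 := by
  rw [LieHom.map_lie, LieRing.of_associative_ring_bracket, map_sub, LinearMap.trace_mul_comm,
    sub_self]

theorem ad_derivation (E : LieDerivation ℝ 𝔤 𝔤) (X : 𝔤) :
    (LieAlgebra.ad ℝ 𝔤 (E X) : 𝔤 →ₗ[ℝ] 𝔤) =
      (E : 𝔤 →ₗ[ℝ] 𝔤) ∘ₗ LieAlgebra.ad ℝ 𝔤 X - LieAlgebra.ad ℝ 𝔤 X ∘ₗ (E : 𝔤 →ₗ[ℝ] 𝔤) := by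
  ext Y
  simp

theorem trace_ad_derivation [FiniteDimensional ℝ 𝔤] (E : LieDerivation ℝ 𝔤 𝔤) (X : 𝔤) :
    LinearMap.trace ℝ 𝔤 (LieAlgebra.ad ℝ 𝔤 (E X)) = 0 := by
  rw [ad_derivation, map_sub, LinearMap.trace_comp_comm', sub_self]

end Lie

/-! ### Connection, Ricci tensor and mean curvature vector of an invariant metric. -/

variable {𝔤 : Type*} [LieRing 𝔤] [LieAlgebra ℝ 𝔤] [FiniteDimensional ℝ 𝔤] (g : InvariantMetric 𝔤)

theorem form_nabla (X Y Z : 𝔤) :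
    g.form (g.nabla X Y) Z = (g.form ⁅X, Y⁆ Z - g.form ⁅Y, Z⁆ X + g.form ⁅Z, X⁆ Y) / 2 := by
  have : g.form.toDual g.nondegenerate (g.nabla X Y) = g.koszul X Y :=
    LinearEquiv.apply_symm_apply _ _
  rw [← LinearMap.BilinForm.toDual_def (b := g.nondegenerate), this]
  rfl

theorem nabla_sub_nabla (X Y : 𝔤) : g.nabla X Y - g.nabla Y X = ⁅X, Y⁆ := by
  refine g.eq_of_forall_form_eq fun Z => ?_
  rw [map_sub, LinearMap.sub_apply, form_nabla, form_nabla, ← lie_skew Y X, ← lie_skew Z X,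
    ← lie_skew Z Y]
  simp only [map_neg, LinearMap.neg_apply]
  ring

theorem form_nabla_left (X Y Z : 𝔤) :
    g.form (g.nabla X Y) Z = -g.form Y (g.nabla X Z) := by
  rw [g.symm Y, form_nabla, form_nabla, ← lie_skew Y X, ← lie_skew Z X, ← lie_skew Z Y]
  simp only [map_neg, LinearMap.neg_apply]
  ring

/-- The endomorphism `Z ↦ ∇_Z Y`. -/
abbrev nablaFlip (Y : 𝔤) : 𝔤 →ₗ[ℝ] 𝔤 := g.nabla.flip Y

theorem nablaFlip_eq (Y : 𝔤) :
    g.nablaFlip Y = g.nabla Y - (LieAlgebra.ad ℝ 𝔤 Y : 𝔤 →ₗ[ℝ] 𝔤) := by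
  ext Z
  simp [← g.nabla_sub_nabla Y Z]

theorem trace_nabla (X : 𝔤) : LinearMap.trace ℝ 𝔤 (g.nabla X) = 0 :=
  g.trace_skew (g.form_nabla_left X)

theorem trace_nablaFlip (Y : 𝔤) :
    LinearMap.trace ℝ 𝔤 (g.nablaFlip Y) = -LinearMap.trace ℝ 𝔤 (LieAlgebra.ad ℝ 𝔤 Y) := by
  rw [nablaFlip_eq, map_sub, trace_nabla, zero_sub]

/-- This trace form of Ricci replaces the curvature in all later computations. -/
theorem ricci_eq (X Y : 𝔤) :
    g.ricci X Y = -LinearMap.trace ℝ 𝔤 (LieAlgebra.ad ℝ 𝔤 (g.nabla X Y)) -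
      LinearMap.trace ℝ 𝔤 (g.nablaFlip X ∘ₗ g.nablaFlip Y) := by
  -- Substituting `[Z, X] = ∇_Z X - ∇_X Z` leaves only products of `nabla` and `nablaFlip`; the two
  -- products of `nabla X` with `nablaFlip Y` cancel under the trace.
  have h : ({ toFun := fun Z => g.curvature Z X Y
              map_add' := fun a b => by simp [curvature]; abel
              map_smul' := fun c a => by simp [curvature, smul_sub] } : 𝔤 →ₗ[ℝ] 𝔤) =
      g.nablaFlip (g.nabla X Y) - g.nabla X ∘ₗ g.nablaFlip Y + g.nablaFlip Y ∘ₗ g.nabla X -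
        g.nablaFlip Y ∘ₗ g.nablaFlip X := by
    ext Z
    simp only [curvature, ← g.nabla_sub_nabla Z X, LinearMap.coe_mk, AddHom.coe_mk,
      LinearMap.sub_apply, LinearMap.add_apply, LinearMap.comp_apply, LinearMap.flip_apply, map_sub]
    abel
  rw [ricci, h, map_sub, map_add, map_sub, trace_nablaFlip,
    LinearMap.trace_comp_comm' (g.nabla X), LinearMap.trace_comp_comm' (g.nablaFlip Y) (g.nablaFlip X)]
  ring

theorem ricci_symm (X Y : 𝔤) : g.ricci X Y = g.ricci Y X := by
  have := trace_ad_lie X Y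
  rw [← g.nabla_sub_nabla X Y, map_sub, map_sub] at this
  rw [ricci_eq, ricci_eq, LinearMap.trace_comp_comm' (g.nablaFlip X)]
  linarith

/-- The mean curvature vector `H`, defined by `⟨H, X⟩ = tr (ad X)`. -/
def meanCurvature : 𝔤 :=
  (g.form.toDual g.nondegenerate).symm
    (LinearMap.trace ℝ 𝔤 ∘ₗ (LieAlgebra.ad ℝ 𝔤 : 𝔤 →ₗ[ℝ] Module.End ℝ 𝔤))

theorem form_meanCurvature (X : 𝔤) :
    g.form g.meanCurvature X = LinearMap.trace ℝ 𝔤 (LieAlgebra.ad ℝ 𝔤 X) := by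
  rw [← LinearMap.BilinForm.toDual_def (b := g.nondegenerate), meanCurvature,
    LinearEquiv.apply_symm_apply]
  rfl

/-- `H` is dual to `X ↦ tr (ad X)`, which vanishes on brackets and so is a closed form; the
covariant derivative of a closed form is symmetric. -/
theorem form_nablaFlip_meanCurvature (X Y : 𝔤) :
    g.form (g.nablaFlip g.meanCurvature X) Y = g.form X (g.nablaFlip g.meanCurvature Y) := by
  have := trace_ad_lie X Y
  rw [← form_meanCurvature g, ← g.nabla_sub_nabla X Y, map_sub] at this
  rw [g.symm X, LinearMap.flip_apply, LinearMap.flip_apply, form_nabla_left, form_nabla_left]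
  linarith

/-- The trace of the Ricci operator against a derivation `E` is `tr (∇H ∘ E)`. -/
theorem sum_ricci_derivation {ι : Type*} [Fintype ι] [DecidableEq ι] {b : Module.Basis ι ℝ 𝔤}
    (hb : ∀ i j, g.form (b i) (b j) = if i = j then 1 else 0) (E : LieDerivation ℝ 𝔤 𝔤) :
    ∑ j, g.ricci (b j) (E (b j)) =
      LinearMap.trace ℝ 𝔤 (g.nablaFlip g.meanCurvature ∘ₗ (E : 𝔤 →ₗ[ℝ] 𝔤)) := by
  -- `C X Z` measures the failure of `E` to be a derivation of `∇`. It is symmetric because `∇` is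
  -- torsion-free and `E` is a derivation of the bracket.
  let C : 𝔤 → 𝔤 →ₗ[ℝ] 𝔤 := fun X =>
    g.nablaFlip (E X) - (E : 𝔤 →ₗ[ℝ] 𝔤) ∘ₗ g.nablaFlip X + g.nablaFlip X ∘ₗ (E : 𝔤 →ₗ[ℝ] 𝔤)
  have hC : ∀ X Z, C X Z = C Z X := fun X Z => by
    have h1 := g.nabla_sub_nabla Z (E X)
    have h2 := g.nabla_sub_nabla (E Z) X
    have h3 := congrArg E (g.nabla_sub_nabla Z X)
    rw [LieDerivation.apply_lie_eq_add, ← h1, ← h2, map_sub] at h3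
    simp only [C, LinearMap.add_apply, LinearMap.sub_apply, LinearMap.comp_apply,
      LinearMap.flip_apply, LieDerivation.coeFn_coe]
    rw [← sub_eq_zero] at h3 ⊢
    rw [← neg_eq_zero, ← h3]
    abel
  have h0 : ∑ j, LinearMap.trace ℝ 𝔤 (g.nablaFlip (b j) ∘ₗ C (b j)) = 0 := by
    -- Exchange the two summation indices: `C` is unchanged and metric compatibility produces the
    -- sign.
    have key : ∑ j, LinearMap.trace ℝ 𝔤 (g.nablaFlip (b j) ∘ₗ C (b j)) =
        -∑ j, LinearMap.trace ℝ 𝔤 (g.nablaFlip (b j) ∘ₗ C (b j)) := by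
      simp only [trace_eq_sum_form hb, LinearMap.comp_apply, LinearMap.flip_apply]
      conv_lhs => rw [Finset.sum_comm]
      simp only [← Finset.sum_neg_distrib]
      refine Finset.sum_congr rfl fun i _ => Finset.sum_congr rfl fun j _ => ?_
      rw [form_nabla_left, hC, g.symm]
    linarith
  -- `C X` differs from `nablaFlip (E X)` by the commutator of `nablaFlip X` with `E`, invisible to
  -- the trace against `nablaFlip X`.
  have h1 : ∀ X, LinearMap.trace ℝ 𝔤 (g.nablaFlip X ∘ₗ g.nablaFlip (E X)) =
      LinearMap.trace ℝ 𝔤 (g.nablaFlip X ∘ₗ C X) := fun X => by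
    simp only [C, LinearMap.comp_add, LinearMap.comp_sub, map_add, map_sub]
    rw [← LinearMap.comp_assoc, ← LinearMap.comp_assoc,
      LinearMap.trace_comp_comm' (g.nablaFlip X) (g.nablaFlip X ∘ₗ (E : 𝔤 →ₗ[ℝ] 𝔤)),
      LinearMap.comp_assoc]
    ring
  rw [trace_eq_sum_form hb]
  simp only [ricci_eq, h1, Finset.sum_sub_distrib, h0, sub_zero]
  refine Finset.sum_congr rfl fun j _ => ?_
  rw [← form_meanCurvature g, LinearMap.comp_apply, form_nablaFlip_meanCurvature,
    g.symm (LieDerivation.toLinearMap E (b j)), LinearMap.flip_apply, form_nabla_left]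
  simp

theorem trace_nablaFlip_meanCurvature_ad (X : 𝔤) :
    LinearMap.trace ℝ 𝔤 (g.nablaFlip g.meanCurvature ∘ₗ LieAlgebra.ad ℝ 𝔤 X) =
      g.ricci g.meanCurvature X := by
  -- By the Koszul formula `∇_H H = 0`, since `H` is orthogonal to all brackets.
  have h1 : g.form g.meanCurvature (g.nabla g.meanCurvature X) = 0 := by
    have h := g.form_nabla g.meanCurvature g.meanCurvature X
    have h2 := g.form_nabla_left g.meanCurvature g.meanCurvature X
    rw [lie_self, g.symm ⁅_, _⁆, g.symm ⁅_, _⁆, form_meanCurvature, form_meanCurvature,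
      trace_ad_lie, trace_ad_lie, map_zero, LinearMap.zero_apply] at h
    linarith
  have h2 := g.trace_skew_comp_symm (g.form_nabla_left X) g.form_nablaFlip_meanCurvature
  rw [LinearMap.trace_comp_comm'] at h2
  rw [ricci_eq, ← form_meanCurvature g, h1, nablaFlip_eq g X, LinearMap.comp_sub, map_sub, h2]
  ring

/-! ### Trace identities of algebraic Ricci solitons. -/

variable {g} {lam : ℝ} {D : LieDerivation ℝ 𝔤 𝔤}

theorem IsAlgebraicRicciSoliton.form_symm (hsol : g.IsAlgebraicRicciSoliton lam D) (X Y : 𝔤) :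
    g.form (D X) Y = g.form X (D Y) := by
  have h1 := hsol X Y
  have h2 := hsol Y X
  rw [ricci_symm, h1] at h2
  simp only [map_add, map_smul, LinearMap.add_apply, LinearMap.smul_apply, g.symm Y X] at h2
  rw [g.symm X]
  linarith

/-- Pair Ricci with the derivation `ad X`. Both sides contain `lam tr (ad X)`, and the other term of
`Ric(H, X)` is `tr (ad (D X)) = 0`. -/
theorem IsAlgebraicRicciSoliton.trace_comp_ad (hsol : g.IsAlgebraicRicciSoliton lam D) (X : 𝔤) :
    LinearMap.trace ℝ 𝔤 ((D : 𝔤 →ₗ[ℝ] 𝔤) ∘ₗ LieAlgebra.ad ℝ 𝔤 X) = 0 := by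
  obtain ⟨b, hb⟩ := g.exists_orthonormal_basis
  have h1 := g.sum_ricci_derivation hb (LieDerivation.ad ℝ 𝔤 X)
  have h2 := g.trace_nablaFlip_meanCurvature_ad X
  have h3 : ((LieDerivation.ad ℝ 𝔤 X : LieDerivation ℝ 𝔤 𝔤) : 𝔤 →ₗ[ℝ] 𝔤) =
      LieAlgebra.ad ℝ 𝔤 X := by
    ext; simp
  rw [h3, h2, hsol, map_add, LinearMap.add_apply, hsol.form_symm, form_meanCurvature,
    trace_ad_derivation, map_smul, LinearMap.smul_apply, form_meanCurvature] at h1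
  have h4 : ∀ j, g.ricci (b j) (LieDerivation.ad ℝ 𝔤 X (b j)) =
      lam * g.form (LieAlgebra.ad ℝ 𝔤 X (b j)) (b j) +
      g.form (((D : 𝔤 →ₗ[ℝ] 𝔤) ∘ₗ LieAlgebra.ad ℝ 𝔤 X) (b j)) (b j) := fun j => by
    rw [hsol, map_add, LinearMap.add_apply, map_smul, LinearMap.smul_apply, hsol.form_symm,
      g.symm]
    simp [g.symm]
  simp only [h4, Finset.sum_add_distrib, ← Finset.mul_sum, ← trace_eq_sum_form hb] at h1
  simpa using h1

/-- Pair Ricci with `D` itself. The right side `tr (∇H ∘ D)` vanishes: split `∇H` into the skew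
`∇_H` and `ad H`. -/
theorem IsAlgebraicRicciSoliton.trace_sq (hsol : g.IsAlgebraicRicciSoliton lam D) :
    LinearMap.trace ℝ 𝔤 ((D : 𝔤 →ₗ[ℝ] 𝔤) ∘ₗ (D : 𝔤 →ₗ[ℝ] 𝔤)) =
      -lam * LinearMap.trace ℝ 𝔤 (D : 𝔤 →ₗ[ℝ] 𝔤) := by
  obtain ⟨b, hb⟩ := g.exists_orthonormal_basis
  have h1 := g.sum_ricci_derivation hb D
  have h2 := g.trace_skew_comp_symm (g.form_nabla_left g.meanCurvature) (T := D) hsol.form_symm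
  have h3 := hsol.trace_comp_ad g.meanCurvature
  rw [LinearMap.trace_comp_comm'] at h3
  rw [nablaFlip_eq, LinearMap.sub_comp, map_sub, h2, h3] at h1
  have h4 : ∀ j, g.ricci (b j) (D (b j)) = lam * g.form ((D : 𝔤 →ₗ[ℝ] 𝔤) (b j)) (b j) +
      g.form (((D : 𝔤 →ₗ[ℝ] 𝔤) ∘ₗ (D : 𝔤 →ₗ[ℝ] 𝔤)) (b j)) (b j) := fun j => by
    rw [hsol, map_add, LinearMap.add_apply, map_smul, LinearMap.smul_apply, ← hsol.form_symm,
      ← hsol.form_symm]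
    simp
  simp only [h4, Finset.sum_add_distrib, ← Finset.mul_sum, ← trace_eq_sum_form hb] at h1
  linarith

/-- For self-adjoint `D`, `tr D²` is the squared norm of `D`. -/
theorem IsAlgebraicRicciSoliton.eq_zero_of_trace_eq_zero (hsol : g.IsAlgebraicRicciSoliton lam D)
    (h : lam * LinearMap.trace ℝ 𝔤 (D : 𝔤 →ₗ[ℝ] 𝔤) = 0) : D = 0 := by
  obtain ⟨b, hb⟩ := g.exists_orthonormal_basis
  have h1 := hsol.trace_sq
  rw [neg_mul, h, neg_zero, trace_eq_sum_form hb] at h1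
  have hnn : ∀ x, 0 ≤ g.form x x := fun x => by
    by_cases hx : x = 0
    · simp [hx]
    · exact (g.pos x hx).le
  have h2 : ∀ j, g.form (((D : 𝔤 →ₗ[ℝ] 𝔤) ∘ₗ (D : 𝔤 →ₗ[ℝ] 𝔤)) (b j)) (b j) =
      g.form (D (b j)) (D (b j)) := fun j => hsol.form_symm _ _
  simp only [h2] at h1
  rw [Finset.sum_eq_zero_iff_of_nonneg fun _ _ => hnn _] at h1
  have h3 : (D : 𝔤 →ₗ[ℝ] 𝔤) = 0 := b.ext fun j => by
    by_contra hne
    exact (g.pos _ hne).ne' (h1 j (Finset.mem_univ _))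
  ext x
  exact LinearMap.congr_fun h3 x

end InvariantMetric

/-! ### Invariance under Lie algebra isomorphisms. -/

namespace InvariantMetric

section Map

variable {𝔤 𝔤' : Type*} [LieRing 𝔤] [LieAlgebra ℝ 𝔤]
  [LieRing 𝔤'] [LieAlgebra ℝ 𝔤'] (g : InvariantMetric 𝔤)
  (e : 𝔤 ≃ₗ⁅ℝ⁆ 𝔤')

theorem map_form_apply (X Y : 𝔤) : (g.map e.toLinearEquiv).form (e X) (e Y) = g.form X Y := by
  have h : ∀ X, e.toLinearEquiv.symm (e X) = X := fun X => e.toLinearEquiv.symm_apply_apply X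
  simp [map, h]

variable [FiniteDimensional ℝ 𝔤] [FiniteDimensional ℝ 𝔤']

theorem map_nabla_apply (X Y : 𝔤) :
    (g.map e.toLinearEquiv).nabla (e X) (e Y) = e (g.nabla X Y) := by
  refine (g.map e.toLinearEquiv).eq_of_forall_form_eq fun Z => ?_
  obtain ⟨Z, rfl⟩ : ∃ W, e W = Z := e.surjective Z
  rw [form_nabla, ← LieEquiv.map_lie, ← LieEquiv.map_lie, ← LieEquiv.map_lie]
  simp only [map_form_apply, form_nabla]

theorem map_ricci_apply (X Y : 𝔤) :
    (g.map e.toLinearEquiv).ricci (e X) (e Y) = g.ricci X Y := by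
  have h1 : ∀ Z : 𝔤, (LieAlgebra.ad ℝ 𝔤' (e Z) : 𝔤' →ₗ[ℝ] 𝔤') =
      e.toLinearEquiv.conj (LieAlgebra.ad ℝ 𝔤 Z) := fun Z => by
    ext W
    obtain ⟨W, rfl⟩ := e.toLinearEquiv.surjective W
    simp only [LinearEquiv.conj_apply_apply, LinearEquiv.symm_apply_apply]
    exact (e.map_lie Z W).symm
  have h2 : ∀ Z : 𝔤, (g.map e.toLinearEquiv).nablaFlip (e Z) =
      e.toLinearEquiv.conj (g.nablaFlip Z) := fun Z => by
    ext W
    obtain ⟨W, rfl⟩ := e.toLinearEquiv.surjective W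
    simp only [LinearEquiv.conj_apply_apply, LinearEquiv.symm_apply_apply]
    exact g.map_nabla_apply e W Z
  rw [ricci_eq, ricci_eq, map_nabla_apply, h1, h2, h2, ← LinearEquiv.conj_comp,
    LinearMap.trace_conj', LinearMap.trace_conj']

theorem map_isEinsteinWith_iff (mu : ℝ) :
    (g.map e.toLinearEquiv).IsEinsteinWith mu ↔ g.IsEinsteinWith mu := by
  refine ⟨fun h X Y => ?_, fun h X Y => ?_⟩
  · simpa only [map_ricci_apply, map_form_apply] using h (e X) (e Y)
  · obtain ⟨X, rfl⟩ : ∃ W, e W = X := e.surjective X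
    obtain ⟨Y, rfl⟩ : ∃ W, e W = Y := e.surjective Y
    rw [map_ricci_apply, map_form_apply, h]

end Map

end InvariantMetric

/-! ### The extension `ℝξ ⋉ 𝔥`: bracket, trace, connection and Ricci tensor. -/

namespace LineExtension

variable {𝔥 : Type*} [LieRing 𝔥] [LieAlgebra ℝ 𝔥] (D : LieDerivation ℝ 𝔥 𝔥) (α : ℝ)

instance [FiniteDimensional ℝ 𝔥] : FiniteDimensional ℝ (LineExtension D α) :=
  (LieAlgebra.SemiDirectSum.toProdl (lineAction (α • D))).symm.finiteDimensional

/-- The unit vector `ξ` acting on `𝔥` by `α D`. -/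
def xi : LineExtension D α := ⟨0, 1⟩

/-- The inclusion of `𝔥` in its extension. -/
def incl : 𝔥 →ₗ[ℝ] LineExtension D α := (LieAlgebra.SemiDirectSum.inl (lineAction (α • D)) : _ →ₗ[ℝ] _)

/-- The `𝔥`-component of a vector of the extension. -/
def projL : LineExtension D α →ₗ[ℝ] 𝔥 := LieAlgebra.SemiDirectSum.projl (lineAction (α • D))

/-- The `ξ`-component of a vector of the extension. -/
def projR : LineExtension D α →ₗ[ℝ] ℝ :=
  (LieAlgebra.SemiDirectSum.projr (lineAction (α • D)) : _ →ₗ[ℝ] _)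

theorem projR_lie (x y : LineExtension D α) : projR D α ⁅x, y⁆ = 0 := by
  simp [projR, LieRing.of_associative_ring_bracket, mul_comm]

theorem lie_def (x y : LineExtension D α) :
    ⁅x, y⁆ = ⟨⁅x.left, y.left⁆ + (x.right * α) • D y.left - (y.right * α) • D x.left, 0⟩ := by
  simp [lineAction, LieRing.of_associative_ring_bracket, mul_comm, smul_smul]
  rfl

theorem trace_eq [FiniteDimensional ℝ 𝔥] (A : LineExtension D α →ₗ[ℝ] LineExtension D α) :
    LinearMap.trace ℝ _ A = LinearMap.trace ℝ 𝔥 (projL D α ∘ₗ A ∘ₗ incl D α) +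
      (A (xi D α)).right := by
  have h1 : A = (A ∘ₗ incl D α) ∘ₗ projL D α +
      (LinearMap.toSpanSingleton ℝ _ (A (xi D α))) ∘ₗ projR D α := by
    refine LinearMap.ext fun x => ?_
    have hx : x = incl D α (projL D α x) + projR D α x • xi D α := by
      ext <;> simp [incl, projL, projR, xi]
    conv_lhs => rw [hx, map_add, map_smul]
    rfl
  conv_lhs => rw [h1]
  rw [map_add, LinearMap.trace_comp_comm' (A ∘ₗ incl D α), 
    LinearMap.trace_comp_comm' (projR D α)]
  congr 1
  rw [LinearMap.trace_eq_matrix_trace ℝ (Module.Basis.singleton Unit ℝ)]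
  simp [Matrix.trace, LinearMap.toMatrix_apply, projR]

end LineExtension

namespace InvariantMetric

open LineExtension

variable {𝔥 : Type*} [LieRing 𝔥] [LieAlgebra ℝ 𝔥]
  {h : InvariantMetric 𝔥} {D : LieDerivation ℝ 𝔥 𝔥}

theorem extend_form_apply (α : ℝ) (x y : LineExtension D α) :
    (h.extend D α).form x y = h.form x.left y.left + x.right * y.right := rfl

variable [FiniteDimensional ℝ 𝔥]

/-- As `ad ξ` is self-adjoint on `𝔥`, `∇_ξ = 0` and `α D` enters only as a second fundamental form.
-/
theorem extend_nabla (hD : ∀ X Y, h.form (D X) Y = h.form X (D Y)) (α : ℝ)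
    (x y : LineExtension D α) :
    (h.extend D α).nabla x y =
      ⟨h.nabla x.left y.left - (y.right * α) • D x.left, α * h.form (D x.left) y.left⟩ := by
  refine (h.extend D α).eq_of_forall_form_eq fun z => ?_
  have h1 := hD z.left x.left
  have h2 := hD z.left y.left
  have h3 := hD x.left y.left
  rw [h.symm] at h1 h2 h3
  rw [form_nabla]
  simp only [extend_form_apply, lie_def, map_add, map_sub, map_smul, LinearMap.add_apply,
    LinearMap.sub_apply, LinearMap.smul_apply, form_nabla, smul_eq_mul]
  simp only [hD]
  linear_combination x.right * α / 2 * h2 + y.right * α / 2 * h1 + z.right * α / 2 * h3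

theorem IsAlgebraicRicciSoliton.trace_nablaFlip_comp {lam : ℝ}
    (hsol : h.IsAlgebraicRicciSoliton lam D) (X : 𝔥) :
    LinearMap.trace ℝ 𝔥 (h.nablaFlip X ∘ₗ (D : 𝔥 →ₗ[ℝ] 𝔥)) = 0 := by
  rw [nablaFlip_eq, LinearMap.sub_comp, map_sub,
    h.trace_skew_comp_symm (h.form_nabla_left X) (T := D) hsol.form_symm,
    LinearMap.trace_comp_comm', hsol.trace_comp_ad, sub_zero]

/-- The cross traces of `D` with `nablaFlip` vanish, and `tr D² = -lam tr D` makes the `𝔥` and `ξ`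
blocks share one factor. -/
theorem IsAlgebraicRicciSoliton.extend_ricci {lam : ℝ} (hsol : h.IsAlgebraicRicciSoliton lam D)
    (α : ℝ) (x y : LineExtension D α) :
    (h.extend D α).ricci x y - lam * (h.extend D α).form x y =
      (1 - α ^ 2 * LinearMap.trace ℝ 𝔥 (D : 𝔥 →ₗ[ℝ] 𝔥)) *
        (h.form (D x.left) y.left - lam * (x.right * y.right)) := by
  have had : ∀ z : LineExtension D α, LinearMap.trace ℝ _ (LieAlgebra.ad ℝ _ z) =
      LinearMap.trace ℝ 𝔥 (LieAlgebra.ad ℝ 𝔥 z.left) +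
        z.right * α * LinearMap.trace ℝ 𝔥 (D : 𝔥 →ₗ[ℝ] 𝔥) := fun z => by
    have : projL D α ∘ₗ (LieAlgebra.ad ℝ _ z : _ →ₗ[ℝ] _) ∘ₗ incl D α =
        (LieAlgebra.ad ℝ 𝔥 z.left : 𝔥 →ₗ[ℝ] 𝔥) + (z.right * α) • (D : 𝔥 →ₗ[ℝ] 𝔥) := by
      ext X
      simp [projL, incl, lie_def, -LieAlgebra.SemiDirectSum.lie_eq_mk]
    rw [trace_eq, this, LieAlgebra.ad_apply, lie_def, map_add, map_smul, smul_eq_mul, add_zero]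
  have hR := hsol.trace_nablaFlip_comp
  have hRR : LinearMap.trace ℝ _ ((h.extend D α).nablaFlip x ∘ₗ (h.extend D α).nablaFlip y) =
      LinearMap.trace ℝ 𝔥 (h.nablaFlip x.left ∘ₗ h.nablaFlip y.left) -
        x.right * y.right * α ^ 2 * lam * LinearMap.trace ℝ 𝔥 (D : 𝔥 →ₗ[ℝ] 𝔥) := by
    have h1 : projL D α ∘ₗ ((h.extend D α).nablaFlip x ∘ₗ (h.extend D α).nablaFlip y) ∘ₗ
        incl D α = (h.nablaFlip x.left - (x.right * α) • (D : 𝔥 →ₗ[ℝ] 𝔥)) ∘ₗ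
          (h.nablaFlip y.left - (y.right * α) • (D : 𝔥 →ₗ[ℝ] 𝔥)) := by
      ext X
      simp [projL, incl, extend_nabla hsol.form_symm]
    have h2 : (((h.extend D α).nablaFlip x ∘ₗ (h.extend D α).nablaFlip y) (xi D α)).right = 0 := by
      simp [extend_nabla hsol.form_symm, xi]
    rw [trace_eq, h1, h2]
    simp only [LinearMap.comp_sub, LinearMap.sub_comp, LinearMap.comp_smul, LinearMap.smul_comp,
      map_sub, map_smul, hR, hsol.trace_sq, smul_eq_mul]
    rw [LinearMap.trace_comp_comm' (h.nablaFlip y.left) (D : 𝔥 →ₗ[ℝ] 𝔥), hR]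
    ring
  have hric := h.ricci_eq x.left y.left
  rw [hsol] at hric
  rw [ricci_eq, had, extend_nabla hsol.form_symm, hRR, extend_form_apply]
  simp only [map_sub, map_smul, trace_ad_derivation, smul_zero, sub_zero] 
  simp only [map_add, map_smul, LinearMap.add_apply, LinearMap.smul_apply, smul_eq_mul] at hric
  linear_combination -hric

theorem IsAlgebraicRicciSoliton.not_isEinstein_extend {lam : ℝ} (α : ℝ)
    (hsol : h.IsAlgebraicRicciSoliton lam D) (hric : ¬ h.IsEinsteinWith 0)
    (hne : ¬ (h.extend D α).IsEinsteinWith lam) : ¬ (h.extend D α).IsEinstein := by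
  rintro ⟨mu, hmu⟩
  set c := 1 - α ^ 2 * LinearMap.trace ℝ 𝔥 (D : 𝔥 →ₗ[ℝ] 𝔥) with hc
  have key := hsol.extend_ricci α
  rw [← hc] at key
  have hc0 : c ≠ 0 := fun h0 => hne fun x y => by
    have := key x y
    rw [h0, zero_mul] at this
    linarith
  have h1 := key (xi D α) (xi D α)
  rw [hmu, extend_form_apply] at h1
  simp [xi] at h1
  refine hric fun X Y => ?_
  have h2 := key ⟨X, 0⟩ ⟨Y, 0⟩
  rw [hmu, extend_form_apply] at h2
  simp at h2
  -- The two blocks give `mu - lam = -c lam` and `(mu - lam) h = c ⟨D·,·⟩`, hence `c Ric_h = 0`.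
  rw [hsol, map_add, map_smul, LinearMap.add_apply, LinearMap.smul_apply, smul_eq_mul, zero_mul]
  refine (mul_eq_zero.1 ?_).resolve_left hc0
  linear_combination -h2 + h1 * h.form X Y

end InvariantMetric

/-! ### Calculus along left-invariant fields: charts, commutators, completeness. -/

section LeftDeriv

open VectorField Set

variable {E : Type*} [NormedAddCommGroup E] [NormedSpace ℝ E]
  {G : Type*} [Group G] [TopologicalSpace G] [ChartedSpace E G]

theorem leftDeriv_add_left (X Y : GroupLieAlgebra 𝓘(ℝ, E) G) (f : G → ℝ) (p : G) :
    leftDeriv (X + Y) f p = leftDeriv X f p + leftDeriv Y f p := by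
  simp only [leftDeriv, mulInvariantVectorField_add, Pi.add_apply]
  exact map_add (mfderiv 𝓘(ℝ, E) 𝓘(ℝ, ℝ) f p) _ _

theorem leftDeriv_smul_left (c : ℝ) (X : GroupLieAlgebra 𝓘(ℝ, E) G) (f : G → ℝ) (p : G) :
    leftDeriv (c • X) f p = c * leftDeriv X f p := by
  simp only [leftDeriv, mulInvariantVectorField_smul, Pi.smul_apply]
  exact map_smul (mfderiv 𝓘(ℝ, E) 𝓘(ℝ, ℝ) f p) _ _

/-- The derivatives of `f` at `p` along left-invariant fields, as a linear functional. -/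
def leftDifferential (f : G → ℝ) (p : G) : GroupLieAlgebra 𝓘(ℝ, E) G →ₗ[ℝ] ℝ where
  toFun X := leftDeriv X f p
  map_add' X Y := leftDeriv_add_left X Y f p
  map_smul' c X := leftDeriv_smul_left c X f p

theorem leftDeriv_add {X : GroupLieAlgebra 𝓘(ℝ, E) G} {f f' : G → ℝ} {p : G}
    (hf : MDifferentiableAt 𝓘(ℝ, E) 𝓘(ℝ, ℝ) f p) (hf' : MDifferentiableAt 𝓘(ℝ, E) 𝓘(ℝ, ℝ) f' p) :
    leftDeriv X (fun q => f q + f' q) p = leftDeriv X f p + leftDeriv X f' p := by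
  have : mfderiv 𝓘(ℝ, E) 𝓘(ℝ, ℝ) (fun q => f q + f' q) p = _ :=
    (hf.hasMFDerivAt.add hf'.hasMFDerivAt).mfderiv
  rw [leftDeriv, this]
  rfl

theorem leftDeriv_comp {X : GroupLieAlgebra 𝓘(ℝ, E) G} {f : G → ℝ} {p : G} {u : ℝ → ℝ} {u' : ℝ}
    (hf : MDifferentiableAt 𝓘(ℝ, E) 𝓘(ℝ, ℝ) f p) (hu : HasDerivAt u u' (f p)) :
    leftDeriv X (fun q => u (f q)) p = u' * leftDeriv X f p := by
  have : mfderiv 𝓘(ℝ, E) 𝓘(ℝ, ℝ) (fun q => u (f q)) p = _ :=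
    (HasMFDerivAt.comp p hu.hasFDerivAt.hasMFDerivAt hf.hasMFDerivAt).mfderiv
  rw [leftDeriv, this, mul_comm]
  rfl

theorem leftDeriv_mul_const {X : GroupLieAlgebra 𝓘(ℝ, E) G} {f : G → ℝ} {p : G}
    (hf : MDifferentiableAt 𝓘(ℝ, E) 𝓘(ℝ, ℝ) f p) (c : ℝ) :
    leftDeriv X (fun q => f q * c) p = leftDeriv X f p * c := by
  rw [leftDeriv_comp (u := fun t => t * c) hf (by simpa using (hasDerivAt_id (f p)).mul_const c),
    mul_comm]

theorem leftDeriv_const (X : GroupLieAlgebra 𝓘(ℝ, E) G) (c : ℝ) (p : G) :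
    leftDeriv X (fun _ : G => c) p = 0 := by
  rw [leftDeriv, mfderiv_const]
  rfl

theorem comp_one_smulRight {F : Type*} [NormedAddCommGroup F] [NormedSpace ℝ F] (A : E →L[ℝ] F)
    (v : E) : A ∘L (1 : ℝ →L[ℝ] ℝ).smulRight v = (1 : ℝ →L[ℝ] ℝ).smulRight (A v) := by
  ext
  simp

theorem hasDerivAt_comp_integralCurve {X : GroupLieAlgebra 𝓘(ℝ, E) G} {γ : ℝ → G}
    (hγ : IsMIntegralCurve (I := 𝓘(ℝ, E)) γ (mulInvariantVectorField X)) {f : G → ℝ}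
    (hf : MDifferentiable 𝓘(ℝ, E) 𝓘(ℝ, ℝ) f) (t : ℝ) :
    HasDerivAt (fun s => f (γ s)) (leftDeriv X f (γ t)) t := by
  have h := HasMFDerivAt.comp t (hf (γ t)).hasMFDerivAt (hγ t)
  have h2 := HasFDerivAt.hasDerivAt (F := ℝ) (f := fun s => f (γ s)) h.hasFDerivAt
  convert! h2 using 1
  exact ((map_smul (mfderiv 𝓘(ℝ, E) 𝓘(ℝ, ℝ) f (γ t)) (1 : ℝ) _).trans (one_smul ℝ _)).symm

variable [LieGroup 𝓘(ℝ, E) ∞ G]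

theorem mfderiv_mul_left_mulInvariantVectorField (X : GroupLieAlgebra 𝓘(ℝ, E) G) (g h : G) :
    mfderiv 𝓘(ℝ, E) 𝓘(ℝ, E) (fun x => g * x) h (mulInvariantVectorField X h) =
      mulInvariantVectorField X (g * h) := by
  have hl : ∀ a : G, MDifferentiable 𝓘(ℝ, E) 𝓘(ℝ, E) (fun x : G => a * x) := fun a =>
    (contMDiff_mul_left (n := ∞)).mdifferentiable (by simp)
  have hc : (fun x => g * h * x) = (fun x => g * x) ∘ (fun x => h * x) := by
    ext x; simp [mul_assoc]
  have h1 := mfderiv_comp_apply_of_eq (1 : G) (hl g h) (hl h 1) (mul_one h) X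
  rw [← hc] at h1
  exact h1.symm

theorem contMDiff_mulInvariantVectorField_two (X : GroupLieAlgebra 𝓘(ℝ, E) G) :
    ContMDiff 𝓘(ℝ, E) 𝓘(ℝ, E).tangent 2
      (fun g : G => (mulInvariantVectorField X g : TangentBundle 𝓘(ℝ, E) G)) := by
  exact (contMDiff_mulInvariantVectorField (𝕜 := ℝ) (I := 𝓘(ℝ, E)) (G := G) X).of_le
    le_minSmoothness

theorem contMDiff_leftDeriv (X : GroupLieAlgebra 𝓘(ℝ, E) G) {f : G → ℝ} {n : ℕ∞ω} (hn : n ≤ 2)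
    (hf : ContMDiff 𝓘(ℝ, E) 𝓘(ℝ, ℝ) (n + 1) f) :
    ContMDiff 𝓘(ℝ, E) 𝓘(ℝ, ℝ) n (leftDeriv X f) :=
  (contMDiff_snd_tangentBundle_modelSpace ℝ 𝓘(ℝ, ℝ)).comp <|
    (hf.contMDiff_tangentMap le_rfl).comp ((contMDiff_mulInvariantVectorField_two X).of_le hn)

section Chart

variable (x₀ : G)

/-- The left-invariant vector field determined by `X`, read in the chart at `x₀`. -/
def chartField (X : GroupLieAlgebra 𝓘(ℝ, E) G) : E → E :=
  mpullback 𝓘(ℝ, E) 𝓘(ℝ, E) (extChartAt 𝓘(ℝ, E) x₀).symm (mulInvariantVectorField X)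

variable {x₀} {y : E}

theorem contMDiffAt_chart_symm (hy : y ∈ (extChartAt 𝓘(ℝ, E) x₀).target) :
    ContMDiffAt 𝓘(ℝ, E) 𝓘(ℝ, E) ∞ (extChartAt 𝓘(ℝ, E) x₀).symm y :=
  (contMDiffOn_extChartAt_symm x₀).contMDiffAt ((isOpen_extChartAt_target x₀).mem_nhds hy)

theorem isInvertible_mfderiv_chart_symm (hy : y ∈ (extChartAt 𝓘(ℝ, E) x₀).target) :
    (mfderiv 𝓘(ℝ, E) 𝓘(ℝ, E) (extChartAt 𝓘(ℝ, E) x₀).symm y).IsInvertible := by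
  have : IsManifold 𝓘(ℝ, E) 1 G := IsManifold.of_le (n := ∞) (by norm_cast)
  have := isInvertible_mfderivWithin_extChartAt_symm (I := 𝓘(ℝ, E)) hy
  rwa [ModelWithCorners.range_eq_univ, mfderivWithin_univ] at this

theorem mfderiv_chart_symm_chartField (hy : y ∈ (extChartAt 𝓘(ℝ, E) x₀).target)
    (X : GroupLieAlgebra 𝓘(ℝ, E) G) :
    mfderiv 𝓘(ℝ, E) 𝓘(ℝ, E) (extChartAt 𝓘(ℝ, E) x₀).symm y (chartField (E := E) x₀ X y) =
      mulInvariantVectorField X ((extChartAt 𝓘(ℝ, E) x₀).symm y) := by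
  exact ContinuousLinearMap.IsInvertible.self_apply_inverse
    (f := (mfderiv 𝓘(ℝ, E) 𝓘(ℝ, E) (extChartAt 𝓘(ℝ, E) x₀).symm y : E →L[ℝ] E))
    (isInvertible_mfderiv_chart_symm hy) _

theorem leftDeriv_chart_symm (hy : y ∈ (extChartAt 𝓘(ℝ, E) x₀).target) {f : G → ℝ}
    (hf : MDifferentiableAt 𝓘(ℝ, E) 𝓘(ℝ, ℝ) f ((extChartAt 𝓘(ℝ, E) x₀).symm y))
    (X : GroupLieAlgebra 𝓘(ℝ, E) G) :
    leftDeriv X f ((extChartAt 𝓘(ℝ, E) x₀).symm y) =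
      fderiv ℝ (f ∘ (extChartAt 𝓘(ℝ, E) x₀).symm) y (chartField x₀ X y) := by
  rw [leftDeriv, ← mfderiv_chart_symm_chartField hy, ← mfderiv_eq_fderiv,
    mfderiv_comp y hf ((contMDiffAt_chart_symm hy).mdifferentiableAt (by simp))]
  rfl

variable [FiniteDimensional ℝ E]

theorem differentiableAt_chartField (hy : y ∈ (extChartAt 𝓘(ℝ, E) x₀).target)
    (X : GroupLieAlgebra 𝓘(ℝ, E) G) :
    DifferentiableAt ℝ (chartField x₀ X) y := by
  have h := MDifferentiableAt.mpullback_vectorField (n := ∞)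
    ((contMDiff_mulInvariantVectorField_two X).mdifferentiable two_ne_zero _)
    (contMDiffAt_chart_symm hy) (isInvertible_mfderiv_chart_symm hy) (by norm_cast)
  exact (((contMDiff_snd_tangentBundle_modelSpace E 𝓘(ℝ, E)).contMDiffAt.mdifferentiableAt
    one_ne_zero).comp _ h).differentiableAt

theorem lieBracket_chartField (hy : y ∈ (extChartAt 𝓘(ℝ, E) x₀).target)
    (X Y : GroupLieAlgebra 𝓘(ℝ, E) G) :
    lieBracket ℝ (chartField x₀ X) (chartField x₀ Y) y = chartField x₀ ⁅X, Y⁆ y := by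
  have h := mpullback_mlieBracket (n := ∞)
    ((contMDiff_mulInvariantVectorField_two X).mdifferentiable two_ne_zero _)
    ((contMDiff_mulInvariantVectorField_two Y).mdifferentiable two_ne_zero _)
    (contMDiffAt_chart_symm hy) (by
      rw [minSmoothness_of_isRCLikeNormedField]; norm_cast)
  rw [← mlieBracketWithin_univ (V := mpullback _ _ _ _), mlieBracketWithin_eq_lieBracketWithin] at h
  have h' := congrFun (lieBracketWithin_univ (𝕜 := ℝ) (V := chartField x₀ X)
    (W := chartField x₀ Y)) y
  refine (h'.symm.trans h.symm).trans ?_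
  rw [← mulInvariantVector_mlieBracket]
  rfl

end Chart

variable [FiniteDimensional ℝ E]

/-- `X (Y f) - Y (X f) = [X, Y] f` for left-invariant fields `X` and `Y`. -/
theorem leftDeriv_comm {f : G → ℝ} (hf : ContMDiff 𝓘(ℝ, E) 𝓘(ℝ, ℝ) 2 f)
    (X Y : GroupLieAlgebra 𝓘(ℝ, E) G) (p : G) :
    leftDeriv X (leftDeriv Y f) p - leftDeriv Y (leftDeriv X f) p = leftDeriv ⁅X, Y⁆ f p := by
  set φ := extChartAt 𝓘(ℝ, E) p with hφ
  set y := φ p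
  have hy : y ∈ φ.target := mem_extChartAt_target p
  have hp : φ.symm y = p := extChartAt_to_inv p
  have hnhds := (isOpen_extChartAt_target (I := 𝓘(ℝ, E)) p).mem_nhds hy
  have hf2 : ContDiffAt ℝ 2 (f ∘ φ.symm) y := by
    rw [← contMDiffAt_iff_contDiffAt]
    exact hf.contMDiffAt.comp y ((contMDiffAt_chart_symm hy).of_le (by norm_cast))
  have hdf : DifferentiableAt ℝ (fderiv ℝ (f ∘ φ.symm)) y :=
    (hf2.fderiv_right (m := 1) le_rfl).differentiableAt one_ne_zero
  -- The second-order term is symmetric in the two fields; antisymmetrising the first-order term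
  -- gives the bracket of the chart fields.
  have key : ∀ X Y : GroupLieAlgebra 𝓘(ℝ, E) G, leftDeriv X (leftDeriv Y f) p =
      fderiv ℝ (fderiv ℝ (f ∘ φ.symm)) y (chartField p X y) (chartField p Y y) +
        fderiv ℝ (f ∘ φ.symm) y (fderiv ℝ (chartField p Y) y (chartField p X y)) := fun X Y => by
    have h1 : leftDeriv Y f ∘ φ.symm =ᶠ[nhds y]
        fun z => fderiv ℝ (f ∘ φ.symm) z (chartField p Y z) := by
      filter_upwards [hnhds] with z hz
      exact leftDeriv_chart_symm hz (hf.mdifferentiable two_ne_zero _) Y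
    have h2 := leftDeriv_chart_symm hy
      (((contMDiff_leftDeriv Y (n := 1) one_le_two hf).mdifferentiable one_ne_zero) _) X
    rw [← hφ, hp] at h2
    rw [h2, h1.fderiv_eq, fderiv_clm_apply hdf (differentiableAt_chartField hy Y)]
    simp [add_comm]
  have h3 := leftDeriv_chart_symm hy (hf.mdifferentiable two_ne_zero _) ⁅X, Y⁆
  rw [← hφ, hp, ← lieBracket_chartField hy, lieBracket, map_sub] at h3
  have hs : IsSymmSndFDerivAt ℝ (f ∘ φ.symm) y := hf2.isSymmSndFDerivAt (by simp)
  rw [key, key, h3, hs.eq]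
  ring

/-- Left-invariant vector fields are complete. -/
theorem exists_integralCurve [T2Space G] (X : GroupLieAlgebra 𝓘(ℝ, E) G) (p : G) :
    ∃ γ : ℝ → G, γ 0 = p ∧ IsMIntegralCurve (I := 𝓘(ℝ, E)) γ (mulInvariantVectorField X) := by
  have : IsManifold 𝓘(ℝ, E) 1 G := IsManifold.of_le (n := ∞) (by norm_cast)
  have hX := (contMDiff_mulInvariantVectorField_two X).of_le one_le_two
  obtain ⟨γ, h0, hγ⟩ := exists_isMIntegralCurveAt_of_contMDiffAt_boundaryless 0 (hX (1 : G))
  obtain ⟨ε, hε, hγ⟩ := isMIntegralCurveAt_iff'.1 hγ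
  rw [Real.ball_eq_Ioo, zero_sub, zero_add] at hγ
  -- Left translates of the curve through `1` are integral curves, so one existence time `ε` serves
  -- at every point.
  refine exists_isMIntegralCurve_of_isMIntegralCurveOn hX hε (fun g => ?_) p
  refine ⟨fun t => g * γ t, by simp [h0], fun t ht => ?_⟩
  have h1 := hγ t ht
  have hg : MDifferentiable 𝓘(ℝ, E) 𝓘(ℝ, E) (fun x : G => g * x) :=
    (contMDiff_mul_left (n := ∞)).mdifferentiable (by simp)
  have h2 := (hg (γ t)).hasMFDerivAt.comp_hasMFDerivWithinAt t h1
  refine HasMFDerivWithinAt.congr_mfderiv h2 ?_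
  refine (comp_one_smulRight (E := E) (F := E)
    (mfderiv 𝓘(ℝ, E) 𝓘(ℝ, E) (fun x => g * x) (γ t))
    (mulInvariantVectorField X (γ t))).trans ?_
  exact congrArg (fun v : E => (1 : ℝ →L[ℝ] ℝ).smulRight v)
    (mfderiv_mul_left_mulInvariantVectorField X g (γ t))

end LeftDeriv

/-! ### Locally constant cocycles on simply connected spaces. -/

section Cocycle

open Filter Topology

/-- On a simply connected, locally path connected space every locally constant additive cocycle
is a coboundary. -/
theorem exists_coboundary_of_simplyConnected {M A : Type*} [TopologicalSpace M]
    [SimplyConnectedSpace M] [LocallyPathConnectedSpace M] [AddCommGroup A]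
    (U : M → Set M) (hU : ∀ i, IsOpen (U i)) (hmem : ∀ x, x ∈ U x) (c : M → M → M → A)
    (hc : ∀ i j, ∀ x ∈ U i ∩ U j, ∀ᶠ y in 𝓝 x, c i j y = c i j x)
    (hcomp : ∀ i j k x, c i j x + c j k x = c i k x) :
    ∃ s : M → M → A, (∀ i, ∀ x ∈ U i, ∀ᶠ y in 𝓝 x, s i y = s i x) ∧
      ∀ i j x, s i x + c i j x = s j x := by
  -- With discrete fibre, the bundle glued from the cocycle is a covering; lifting the identity of
  -- `M` gives a global section.
  let _ : TopologicalSpace A := ⊥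
  have : DiscreteTopology A := ⟨rfl⟩
  have hself : ∀ i x, c i i x = 0 := fun i x => by simpa using hcomp i i i x
  let Z : FiberBundleCore M M A :=
    { baseSet := U
      isOpen_baseSet := hU
      indexAt := id
      mem_baseSet_at := hmem
      coordChange := fun i j x v => v + c i j x
      coordChange_self := fun i x _ v => by simp [hself]
      continuousOn_coordChange := fun i j => by
        rintro ⟨x, v⟩ ⟨hx, -⟩
        refine ContinuousAt.continuousWithinAt ?_
        refine ContinuousAt.add continuousAt_snd ?_
        have h : (fun p : M × A => c i j p.1) =ᶠ[𝓝 (x, v)] fun _ => c i j x :=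
          (continuous_fst.continuousAt (x := (x, v))).eventually (hc i j x hx)
        exact continuousAt_const.congr h.symm
      coordChange_comp := fun i j k x _ v => by rw [add_assoc, hcomp] }
  have hcov : IsCoveringMap (Bundle.TotalSpace.proj : Bundle.TotalSpace A Z.Fiber → M) :=
    FiberBundle.isCoveringMap
  obtain ⟨x₀⟩ : Nonempty M := inferInstance
  obtain ⟨F, ⟨-, hF⟩, -⟩ := hcov.existsUnique_continuousMap_lifts (ContinuousMap.id M) x₀
    ⟨x₀, (0 : A)⟩ rfl
  have hF : ∀ x, (F x).proj = x := fun x => congrFun hF x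
  let v : M → A := fun x => (F x).snd
  -- `v x` is the coordinate of the section in the trivialisation indexed by `x`; adding `c x i x`
  -- passes to the one indexed by `i`.
  refine ⟨fun i x => v x + c x i x, fun i x hx => ?_, fun i j x => by
    rw [add_assoc, hcomp]⟩
  have hcont : ContinuousAt (fun y => (Z.localTriv i (F y)).2) x := by
    refine continuous_snd.continuousAt.comp (ContinuousAt.comp ?_ F.continuous.continuousAt)
    refine (Z.localTriv i).continuousOn.continuousAt ((Z.localTriv i).open_source.mem_nhds ?_)
    rw [Z.mem_localTriv_source, hF]
    exact hx
  have h := hcont.eventually (isOpen_discrete {(Z.localTriv i (F x)).2} |>.mem_nhds rfl)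
  have heq : ∀ y, (Z.localTriv i (F y)).2 = v y + c y i y := fun y => by
    change v y + c (F y).proj i (F y).proj = _
    rw [hF]
  filter_upwards [h] with y hy
  rw [← heq, ← heq]
  exact hy

end Cocycle

/-! ### Primitives of closed left-invariant forms. -/

section Primitive

open VectorField Set Topology

variable {E : Type*} [NormedAddCommGroup E] [NormedSpace ℝ E]
  {G : Type*} [Group G] [TopologicalSpace G] [ChartedSpace E G]

theorem mulInvariantVectorField_one (X : GroupLieAlgebra 𝓘(ℝ, E) G) :
    mulInvariantVectorField X (1 : G) = X := by
  have : (fun x : G => (1 : G) * x) = id := by ext; simp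
  rw [mulInvariantVectorField, this, mfderiv_id]
  rfl

variable [LieGroup 𝓘(ℝ, E) ∞ G]

theorem mulInvariantVectorField_surjective (g : G) (v : TangentSpace 𝓘(ℝ, E) g) :
    ∃ X : GroupLieAlgebra 𝓘(ℝ, E) G, mulInvariantVectorField X g = v := by
  have hl : ∀ a : G, MDifferentiable 𝓘(ℝ, E) 𝓘(ℝ, E) (fun x : G => a * x) := fun a =>
    (contMDiff_mul_left (n := ∞)).mdifferentiable (by simp)
  have h1 := mfderiv_comp_apply_of_eq g (hl g 1) (hl g⁻¹ g) (inv_mul_cancel g) v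
  refine ⟨mfderiv 𝓘(ℝ, E) 𝓘(ℝ, E) (fun x => g⁻¹ * x) g v, h1.symm.trans ?_⟩
  have : (fun x : G => g * x) ∘ (fun x => g⁻¹ * x) = id := by ext; simp
  rw [this, mfderiv_id]
  rfl

theorem chartField_surjective {x₀ : G} {y : E} (hy : y ∈ (extChartAt 𝓘(ℝ, E) x₀).target) (v : E) :
    ∃ X, chartField x₀ X y = v := by
  obtain ⟨X, hX⟩ := mulInvariantVectorField_surjective ((extChartAt 𝓘(ℝ, E) x₀).symm y)
    (mfderiv 𝓘(ℝ, E) 𝓘(ℝ, E) (extChartAt 𝓘(ℝ, E) x₀).symm y v)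
  refine ⟨X, ?_⟩
  have h := isInvertible_mfderiv_chart_symm hy
  refine ContinuousLinearMap.IsInvertible.injective
    (f := (mfderiv 𝓘(ℝ, E) 𝓘(ℝ, E) (extChartAt 𝓘(ℝ, E) x₀).symm y : E →L[ℝ] E)) h ?_
  exact (mfderiv_chart_symm_chartField hy X).trans hX

/-- If all left-invariant derivatives of `f` vanish near `p`, then `f` is constant near `p`. -/
theorem eventually_eq_of_leftDeriv_eq_zero {f : G → ℝ} {U : Set G} (hU : IsOpen U) {p : G}
    (hp : p ∈ U) (hf : ∀ q ∈ U, MDifferentiableAt 𝓘(ℝ, E) 𝓘(ℝ, ℝ) f q)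
    (h0 : ∀ q ∈ U, ∀ X : GroupLieAlgebra 𝓘(ℝ, E) G, leftDeriv X f q = 0) :
    ∀ᶠ q in 𝓝 p, f q = f p := by
  set φ := extChartAt 𝓘(ℝ, E) p with hφ
  have hy : φ p ∈ φ.target := mem_extChartAt_target p
  have hpp : φ.symm (φ p) = p := extChartAt_to_inv p
  have hV : φ.target ∩ φ.symm ⁻¹' U ∈ 𝓝 (φ p) := by
    refine Filter.inter_mem ((isOpen_extChartAt_target (I := 𝓘(ℝ, E)) p).mem_nhds hy) ?_
    refine (contMDiffAt_chart_symm hy).continuousAt.preimage_mem_nhds (hU.mem_nhds ?_)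
    rwa [← hφ, hpp]
  obtain ⟨ε, hε, hball⟩ := Metric.mem_nhds_iff.1 hV
  have hd : ∀ y ∈ Metric.ball (φ p) ε, HasFDerivAt (f ∘ φ.symm) (0 : E →L[ℝ] ℝ) y := by
    intro y hyb
    obtain ⟨hyt, hyU⟩ := hball hyb
    have hdiff : DifferentiableAt ℝ (f ∘ φ.symm) y :=
      ((hf _ hyU).comp y ((contMDiffAt_chart_symm hyt).mdifferentiableAt (by simp))).differentiableAt
    have : fderiv ℝ (f ∘ φ.symm) y = 0 := by
      ext v
      obtain ⟨X, rfl⟩ := chartField_surjective hyt v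
      rw [← leftDeriv_chart_symm hyt (hf _ hyU), h0 _ hyU]
      rfl
    rw [← this]
    exact hdiff.hasFDerivAt
  have hconst : ∀ y ∈ Metric.ball (φ p) ε, f (φ.symm y) = f p := fun y hyb => by
    have := (convex_ball (φ p) ε).is_const_of_fderivWithin_eq_zero (𝕜 := ℝ) (f := f ∘ φ.symm)
      (fun z hz => (hd z hz).differentiableAt.differentiableWithinAt)
      (fun z hz => by
        rw [fderivWithin_of_isOpen Metric.isOpen_ball hz, (hd z hz).fderiv])
      hyb (Metric.mem_ball_self hε)
    simpa only [Function.comp_apply, hpp] using this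
  have hcont : ContinuousAt φ p := continuousAt_extChartAt p
  filter_upwards [hcont.preimage_mem_nhds (Metric.ball_mem_nhds _ hε),
    extChartAt_source_mem_nhds (I := 𝓘(ℝ, E)) p] with q hq hqs
  rw [← hconst _ hq, φ.left_inv hqs]

/-- A left-invariant `1`-form, read in the chart at `x₀`, is a smooth form. -/
theorem exists_chart_form (θ : GroupLieAlgebra 𝓘(ℝ, E) G →L[ℝ] ℝ) (x₀ : G) :
    ∃ η : E → E →L[ℝ] ℝ, ContDiffOn ℝ ∞ η (extChartAt 𝓘(ℝ, E) x₀).target ∧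
      ∀ y ∈ (extChartAt 𝓘(ℝ, E) x₀).target, ∀ X, η y (chartField x₀ X y) = θ X := by
  set φ := extChartAt 𝓘(ℝ, E) x₀ with hφ
  set ψ := extChartAt 𝓘(ℝ, E) (1 : G) with hψ
  -- The derivative of `K y` at `y` is the Maurer–Cartan form in charts, up to the isomorphism `A`.
  -- Joint smoothness of `K` makes `η` smooth to all orders.
  let K : E → E → E := fun y z => ψ ((φ.symm y)⁻¹ * φ.symm z)
  let A : E →L[ℝ] E := mfderiv 𝓘(ℝ, E) 𝓘(ℝ, E) ψ (1 : G)
  have hA : A.IsInvertible := by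
    have : IsManifold 𝓘(ℝ, E) 1 G := IsManifold.of_le (n := ∞) (by norm_cast)
    exact isInvertible_mfderiv_extChartAt (mem_extChartAt_source (1 : G))
  have hψs : ContMDiffAt 𝓘(ℝ, E) 𝓘(ℝ, E) ∞ ψ (1 : G) := contMDiffAt_extChartAt
  have hK : ∀ y ∈ φ.target, ContDiffAt ℝ ∞ (Function.uncurry K) (y, y) := fun y hy => by
    rw [← contMDiffAt_iff_contDiffAt]
    have h1 : ContMDiffAt (𝓘(ℝ, E × E)) 𝓘(ℝ, E) ∞ (fun q : E × E => φ.symm q.1) (y, y) :=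
      ContMDiffAt.comp (y, y) (contMDiffAt_chart_symm hy) contDiff_fst.contMDiff.contMDiffAt
    have h2 : ContMDiffAt (𝓘(ℝ, E × E)) 𝓘(ℝ, E) ∞ (fun q : E × E => φ.symm q.2) (y, y) :=
      ContMDiffAt.comp (y, y) (contMDiffAt_chart_symm hy) contDiff_snd.contMDiff.contMDiffAt
    refine ContMDiffAt.comp_of_eq (g := ψ) hψs (h1.inv.mul h2) (by simp)
  let θ' : E →L[ℝ] ℝ := (θ : E →L[ℝ] ℝ) ∘L A.inverse
  refine ⟨fun y => θ' ∘L fderiv ℝ (K y) y, fun y hy => ?_, fun y hy X => ?_⟩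
  · have h := ContDiffAt.fderiv (m := ∞) (hK y hy) contDiffAt_id (by simp)
    exact (contDiffAt_const.clm_comp h).contDiffWithinAt
  · have hl : MDifferentiable 𝓘(ℝ, E) 𝓘(ℝ, E) (fun x : G => (φ.symm y)⁻¹ * x) :=
      (contMDiff_mul_left (n := ∞)).mdifferentiable (by simp)
    have h1 : fderiv ℝ (K y) y (chartField x₀ X y) = A X := by
      have hφd : MDifferentiableAt 𝓘(ℝ, E) 𝓘(ℝ, E) φ.symm y := (contMDiffAt_chart_symm hy).mdifferentiableAt (by simp)
      have e1 := mfderiv_comp_apply_of_eq y (g := ψ)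
        (hψs.mdifferentiableAt (by simp)) ((hl _).comp y hφd)
        (inv_mul_cancel _) (chartField (E := E) x₀ X y)
      have e2 := mfderiv_comp_apply y (hl _) hφd (chartField (E := E) x₀ X y)
      have e3 := mfderiv_chart_symm_chartField hy X
      have e4 := mfderiv_mul_left_mulInvariantVectorField X (φ.symm y)⁻¹ (φ.symm y)
      have e5 : ∀ g : G, g = 1 → (mulInvariantVectorField X g : E) = X := by
        rintro g rfl
        exact mulInvariantVectorField_one X
      have e6 := e2.trans ((congrArg (mfderiv 𝓘(ℝ, E) 𝓘(ℝ, E)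
        (fun x : G => (φ.symm y)⁻¹ * x) (φ.symm y)) e3).trans e4)
      rw [← mfderiv_eq_fderiv]
      exact e1.trans (congrArg A (e6.trans (e5 _ (inv_mul_cancel _))))
    change θ (A.inverse (fderiv ℝ (K y) y (chartField x₀ X y))) = θ X
    rw [h1]
    exact congrArg θ (hA.inverse_apply_self X)

variable [FiniteDimensional ℝ E]

theorem exists_local_primitive (θ : GroupLieAlgebra 𝓘(ℝ, E) G →L[ℝ] ℝ)
    (hθ : ∀ X Y : GroupLieAlgebra 𝓘(ℝ, E) G, θ ⁅X, Y⁆ = 0) (x₀ : G) :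
    ∃ (U : Set G) (f : G → ℝ), IsOpen U ∧ x₀ ∈ U ∧ ContMDiffOn 𝓘(ℝ, E) 𝓘(ℝ, ℝ) ∞ f U ∧
      ∀ p ∈ U, ∀ X, leftDeriv X f p = θ X := by
  obtain ⟨η, hη, hηX⟩ := exists_chart_form θ x₀
  set φ := extChartAt 𝓘(ℝ, E) x₀ with hφ
  have hopen : IsOpen φ.target := isOpen_extChartAt_target x₀
  obtain ⟨ε, hε, hball⟩ := Metric.mem_nhds_iff.1 (hopen.mem_nhds (mem_extChartAt_target x₀))
  have hηd : ∀ y ∈ φ.target, DifferentiableAt ℝ η y := fun y hy =>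
    ((hη y hy).contDiffAt (hopen.mem_nhds hy)).differentiableAt (by simp)
  have hclosed : ∀ y ∈ Metric.ball (φ x₀) ε, ∀ u v, fderiv ℝ η y u v = fderiv ℝ η y v u := by
    intro y hyb u v
    have hy := hball hyb
    obtain ⟨X, rfl⟩ := chartField_surjective hy u
    obtain ⟨Y, rfl⟩ := chartField_surjective hy v
    -- Differentiating the constant `η(X) = θ X` trades derivatives of `η` for those of the chart
    -- fields; the antisymmetric part is then `θ [X, Y] = 0`, so the Poincaré lemma applies on the
    -- ball.
    have key : ∀ (X : GroupLieAlgebra 𝓘(ℝ, E) G) (Z : E), fderiv ℝ η y Z (chartField x₀ X y) +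
        η y (fderiv ℝ (chartField x₀ X) y Z) = 0 := fun X Z => by
      have h1 : (fun z => η z (chartField x₀ X z)) =ᶠ[𝓝 y] fun _ => θ X := by
        filter_upwards [hopen.mem_nhds hy] with z hz using hηX z hz X
      have h2 := h1.fderiv_eq (𝕜 := ℝ)
      rw [fderiv_clm_apply (hηd y hy) (differentiableAt_chartField hy X), fderiv_const_apply] at h2
      have := congrArg (fun B : E →L[ℝ] ℝ => B Z) h2
      simpa [add_comm] using this
    have h3 := hηX y hy ⁅X, Y⁆
    rw [← lieBracket_chartField hy, lieBracket, map_sub, hθ] at h3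
    linear_combination key Y (chartField x₀ X y) - key X (chartField x₀ Y y) - h3
  obtain ⟨F, hF⟩ := (convex_ball (φ x₀) ε).exists_forall_hasFDerivAt_of_fderiv_symmetric
    Metric.isOpen_ball (fun y hy => (hηd y (hball hy)).differentiableWithinAt) hclosed
  have hFs : ContDiffOn ℝ ∞ F (Metric.ball (φ x₀) ε) := by
    refine (contDiffOn_infty_iff_fderiv_of_isOpen Metric.isOpen_ball).2
      ⟨fun y hy => (hF y hy).differentiableAt.differentiableWithinAt, ?_⟩
    exact (hη.mono hball).congr fun y hy => (hF y hy).fderiv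
  refine ⟨φ.source ∩ φ ⁻¹' Metric.ball (φ x₀) ε, F ∘ φ, ?_, ?_, ?_, ?_⟩
  · exact (continuousOn_extChartAt x₀).isOpen_inter_preimage (isOpen_extChartAt_source x₀)
      Metric.isOpen_ball
  · exact ⟨mem_extChartAt_source x₀, Metric.mem_ball_self hε⟩
  · refine ContMDiffOn.comp (t := Metric.ball (φ x₀) ε) hFs.contMDiffOn ?_ fun p hp => hp.2
    refine (contMDiffOn_extChartAt (x := x₀)).mono fun p hp => ?_
    rw [← extChartAt_source 𝓘(ℝ, E)]
    exact hp.1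
  · rintro p ⟨hps, hpb⟩ X
    have hpt := hball hpb
    have hpp : φ.symm (φ p) = p := φ.left_inv hps
    have hd : MDifferentiableAt 𝓘(ℝ, E) 𝓘(ℝ, ℝ) (F ∘ φ) (φ.symm (φ p)) := by
      rw [hpp]
      refine (hF _ hpb).differentiableAt.mdifferentiableAt.comp p ?_
      refine mdifferentiableAt_extChartAt ?_
      rwa [← extChartAt_source 𝓘(ℝ, E)]
    have h1 := leftDeriv_chart_symm hpt hd X
    rw [← hφ, hpp] at h1
    have h2 : (F ∘ φ) ∘ φ.symm =ᶠ[𝓝 (φ p)] F := by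
      filter_upwards [hopen.mem_nhds hpt] with z hz
      simp [φ.right_inv hz]
    rw [h1, h2.fderiv_eq, (hF _ hpb).fderiv, hηX _ hpt]

/-- On a simply connected Lie group, a linear functional vanishing on brackets is the differential
of a smooth function. -/
theorem exists_primitive [SimplyConnectedSpace G] (θ : GroupLieAlgebra 𝓘(ℝ, E) G →L[ℝ] ℝ)
    (hθ : ∀ X Y : GroupLieAlgebra 𝓘(ℝ, E) G, θ ⁅X, Y⁆ = 0) :
    ∃ f : G → ℝ, ContMDiff 𝓘(ℝ, E) 𝓘(ℝ, ℝ) ∞ f ∧ ∀ X p, leftDeriv X f p = θ X := by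
  have : LocallyPathConnectedSpace G := ChartedSpace.locallyPathConnectedSpace E G
  choose U f hU hmem hf hfX using exists_local_primitive (G := G) θ hθ
  have hfd : ∀ i, ∀ x ∈ U i, ContMDiffAt 𝓘(ℝ, E) 𝓘(ℝ, ℝ) ∞ (f i) x := fun i x hx =>
    (hf i).contMDiffAt ((hU i).mem_nhds hx)
  have hfd' : ∀ i, ∀ x ∈ U i, MDifferentiableAt 𝓘(ℝ, E) 𝓘(ℝ, ℝ) (f i) x := fun i x hx =>
    (hfd i x hx).mdifferentiableAt (by simp)
  have hmul : ∀ t : ℝ, HasDerivAt (fun t : ℝ => -1 * t) (-1) t := fun t => by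
    simpa using (hasDerivAt_id t).const_mul (-1 : ℝ)
  have hneg : ∀ i, ∀ x ∈ U i, MDifferentiableAt 𝓘(ℝ, E) 𝓘(ℝ, ℝ) (fun y => -1 * f i y) x :=
    fun i x hx => MDifferentiableAt.comp (g := fun t : ℝ => -1 * t) x
      (hmul _).differentiableAt.mdifferentiableAt (hfd' i x hx)
  obtain ⟨s, hs, hsc⟩ := exists_coboundary_of_simplyConnected U hU hmem
    (fun i j x => f i x + -1 * f j x) (fun i j x hx => by
      refine eventually_eq_of_leftDeriv_eq_zero (E := E) ((hU i).inter (hU j)) hx (fun q hq => ?_)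
        fun q hq X => ?_
      · exact (hfd' i q hq.1).add (hneg j q hq.2)
      · rw [leftDeriv_add (hfd' i q hq.1) (hneg j q hq.2),
          leftDeriv_comp (hfd' j q hq.2) (hmul (f j q)), hfX i q hq.1, hfX j q hq.2]
        ring)
    (fun i j k x => by ring)
  -- The coboundary relation says that `f i + s i` does not depend on `i`, so the local primitives,
  -- corrected by constants, glue along the diagonal.
  have hloc : ∀ x, (fun y => f y y + s y y) =ᶠ[𝓝 x] fun y => f x y + s x x := fun x => by
    filter_upwards [hs x x (hmem x)] with y hy
    rw [← hy]
    linear_combination -hsc x y y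
  refine ⟨fun y => f y y + s y y, fun x => ?_, fun X x => ?_⟩
  · exact ((hfd x x (hmem x)).add contMDiffAt_const).congr_of_eventuallyEq (hloc x)
  · have h1 : leftDeriv X (fun y => f y y + s y y) x = leftDeriv X (fun y => f x y + s x x) x := by
      rw [leftDeriv, (hloc x).mfderiv_eq]
      rfl
    rw [h1, leftDeriv_add (hfd' x x (hmem x)) mdifferentiableAt_const, leftDeriv_const, add_zero,
      hfX x x (hmem x)]

end Primitive

/-! ### The quasi-Einstein equation: integrability, necessity and construction. -/

section QuasiEinstein

variable {E : Type*} [NormedAddCommGroup E] [NormedSpace ℝ E] [FiniteDimensional ℝ E]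
  {G : Type*} [Group G] [TopologicalSpace G] [ChartedSpace E G] [LieGroup 𝓘(ℝ, E) ∞ G]

namespace IsQuasiEinstein

variable {g : InvariantMetric (GroupLieAlgebra 𝓘(ℝ, E) G)} {m lam : ℝ} {w : G → ℝ}

theorem contMDiff_leftDeriv (hw : IsQuasiEinstein g m lam w) (X : GroupLieAlgebra 𝓘(ℝ, E) G) :
    ContMDiff 𝓘(ℝ, E) 𝓘(ℝ, ℝ) 2 (leftDeriv X w) :=
  _root_.contMDiff_leftDeriv X le_rfl (hw.smooth.of_le (by norm_cast))

theorem leftDeriv_leftDeriv (hw : IsQuasiEinstein g m lam w) (X Y : GroupLieAlgebra 𝓘(ℝ, E) G)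
    (p : G) : leftDeriv X (leftDeriv Y w) p =
      leftDeriv (g.nabla X Y) w p + w p * ((g.ricci X Y - lam * g.form X Y) / m) := by
  have := hw.equation X Y p
  rw [hessian] at this
  linear_combination this

/-- The integrability condition of the quasi-Einstein equation. -/
theorem leftDeriv_curvature (hw : IsQuasiEinstein g m lam w)
    {q : GroupLieAlgebra 𝓘(ℝ, E) G → GroupLieAlgebra 𝓘(ℝ, E) G → ℝ}
    (hq : ∀ X Y, (g.ricci X Y - lam * g.form X Y) / m = q X Y)
    (X Y Z : GroupLieAlgebra 𝓘(ℝ, E) G) (p : G) :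
    leftDeriv (g.curvature X Y Z) w p = w p * (q Y (g.nabla X Z) - q X (g.nabla Y Z) + q ⁅X, Y⁆ Z) +
      (leftDeriv Y w p * q X Z - leftDeriv X w p * q Y Z) := by
  have hd : MDifferentiable 𝓘(ℝ, E) 𝓘(ℝ, ℝ) w := hw.smooth.mdifferentiable (by simp)
  have h2 : ∀ X Y, leftDeriv X (leftDeriv Y w) = fun p => leftDeriv (g.nabla X Y) w p + w p * q X Y :=
    fun X Y => funext fun p => by rw [hw.leftDeriv_leftDeriv, hq]
  have h3 : ∀ X Y, leftDeriv X (leftDeriv Y (leftDeriv Z w)) p =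
      leftDeriv (g.nabla X (g.nabla Y Z)) w p + w p * q X (g.nabla Y Z) + leftDeriv X w p * q Y Z :=
    fun X Y => by
      have hc : MDifferentiableAt 𝓘(ℝ, E) 𝓘(ℝ, ℝ) (fun p => w p * q Y Z) p :=
        MDifferentiableAt.comp (g := fun t : ℝ => t * q Y Z) p
          (differentiableAt_id.mul_const (q Y Z)).mdifferentiableAt (hd p)
      rw [h2 Y Z, leftDeriv_add ((hw.contMDiff_leftDeriv _).mdifferentiable two_ne_zero p) hc,
        leftDeriv_mul_const (hd p), h2]
  have h4 := leftDeriv_comm (hw.contMDiff_leftDeriv Z) X Y p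
  rw [h3, h3, h2] at h4
  have h5 : leftDeriv (g.curvature X Y Z) w p = leftDeriv (g.nabla X (g.nabla Y Z)) w p -
      leftDeriv (g.nabla Y (g.nabla X Z)) w p - leftDeriv (g.nabla ⁅X, Y⁆ Z) w p := by
    change leftDifferential w p (g.curvature X Y Z) = _
    rw [InvariantMetric.curvature, map_sub, map_sub]
    rfl
  rw [h5]
  linear_combination h4

end IsQuasiEinstein

/-- The equation `f'' = -c f` with `c > 0` has no positive solution on the line. -/
theorem not_forall_pos_of_hasDerivAt {f f' : ℝ → ℝ} {c : ℝ} (hc : 0 < c)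
    (hf : ∀ t, HasDerivAt f (f' t) t) (hf' : ∀ t, HasDerivAt f' (-c * f t) t) :
    ¬ ∀ t, 0 < f t := by
  intro hpos
  set r := √c with hr
  have hr0 : 0 < r := Real.sqrt_pos.2 hc
  have hrr : r * r = c := Real.mul_self_sqrt hc.le
  -- This is the Wronskian of `f` with `sin (r t)`; its constancy over half a period forces `f (π/r)
  -- = -f 0`.
  have hW : ∀ t, HasDerivAt (fun s => f' s * Real.sin (r * s) - r * (f s * Real.cos (r * s))) 0 t :=
    fun t => by
      have hl : HasDerivAt (fun s : ℝ => r * s) r t := by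
        simpa using (hasDerivAt_id t).const_mul r
      convert! ((hf' t).mul hl.sin).sub (((hf t).mul hl.cos).const_mul r) using 1
      rw [← hrr]
      ring
  have h := is_const_of_deriv_eq_zero (fun t => (hW t).differentiableAt) (fun t => (hW t).deriv)
    0 (Real.pi / r)
  have h1 : r * (Real.pi / r) = Real.pi := by field_simp
  simp only [h1, mul_zero, Real.sin_zero, Real.cos_zero, Real.sin_pi, Real.cos_pi] at h
  have := mul_pos hr0 (hpos 0)
  have := mul_pos hr0 (hpos (Real.pi / r))
  linarith

namespace InvariantMetric.IsAlgebraicRicciSoliton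

open LineExtension

variable {𝔥 : Type*} [LieRing 𝔥] [LieAlgebra ℝ 𝔥] [FiniteDimensional ℝ 𝔥]
  {h : InvariantMetric 𝔥} {lam : ℝ} {D : LieDerivation ℝ 𝔥 𝔥} {m α : ℝ}
  (e : LineExtension D α ≃ₗ⁅ℝ⁆ GroupLieAlgebra 𝓘(ℝ, E) G)

theorem map_extend_ricci (hsol : h.IsAlgebraicRicciSoliton lam D) (x y : LineExtension D α) :
    ((h.extend D α).map e.toLinearEquiv).ricci (e x) (e y) -
        lam * ((h.extend D α).map e.toLinearEquiv).form (e x) (e y) =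
      (1 - α ^ 2 * LinearMap.trace ℝ 𝔥 (D : 𝔥 →ₗ[ℝ] 𝔥)) *
        (h.form (D x.left) y.left - lam * (x.right * y.right)) := by
  rw [map_ricci_apply, map_form_apply, hsol.extend_ricci]

/-- Pairing with `X` gives `-tr (nablaFlip X ∘ D)`. This removes the `𝔥`-derivatives of `w` from the
traced integrability condition. -/
theorem sum_nabla_eq_zero (hsol : h.IsAlgebraicRicciSoliton lam D) {ι : Type*} [Fintype ι]
    [DecidableEq ι] {b : Module.Basis ι ℝ 𝔥}
    (hb : ∀ i j, h.form (b i) (b j) = if i = j then 1 else 0) :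
    ∑ i, h.nabla (D (b i)) (b i) = 0 := by
  refine h.eq_of_forall_form_eq fun X => ?_
  have h1 := hsol.trace_nablaFlip_comp X
  rw [trace_eq_sum_form hb] at h1
  rw [map_sum, LinearMap.sum_apply, map_zero, LinearMap.zero_apply, ← neg_eq_zero,
    ← Finset.sum_neg_distrib, ← h1]
  refine Finset.sum_congr rfl fun i _ => ?_
  rw [form_nabla_left, neg_neg, h.symm]
  rfl

/-- The trace over `𝔥` of the integrability condition. -/
theorem leftDeriv_xi_eq (hsol : h.IsAlgebraicRicciSoliton lam D) {w : G → ℝ}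
    (hw : IsQuasiEinstein ((h.extend D α).map e.toLinearEquiv) m lam w) (p : G) :
    leftDeriv (e (xi D α)) w p * LinearMap.trace ℝ 𝔥 (D : 𝔥 →ₗ[ℝ] 𝔥) *
      ((1 - α ^ 2 * LinearMap.trace ℝ 𝔥 (D : 𝔥 →ₗ[ℝ] 𝔥)) / m + lam * α ^ 2) = 0 := by
  set T := LinearMap.trace ℝ 𝔥 (D : 𝔥 →ₗ[ℝ] 𝔥) with hT
  set κ := (1 - α ^ 2 * T) / m with hκ
  set g := (h.extend D α).map e.toLinearEquiv with hg
  have hq : ∀ x y, (g.ricci (e x) (e y) - lam * g.form (e x) (e y)) / m =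
      κ * (h.form (D x.left) y.left - lam * (x.right * y.right)) := fun x y => by
    rw [hsol.map_extend_ricci e, hκ]
    ring
  obtain ⟨b, hb⟩ := h.exists_orthonormal_basis
  let W : 𝔥 →ₗ[ℝ] ℝ := leftDifferential (E := E) w p ∘ₗ (e.toLinearEquiv : _ →ₗ[ℝ] _) ∘ₗ incl D α
  -- Integrability for the triple `X, ξ, X`, where `R(X, ξ)X = α (∇_{DX} X + α ⟨D²X, X⟩ ξ)`.
  have key : ∀ X, α * W (h.nabla (D X) X) + α ^ 2 * h.form (D (D X)) X * leftDeriv (e (xi D α)) w p =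
      w p * (-(κ * lam * α * h.form (D X) X) - κ * α * h.form (D (D X)) X) +
        leftDeriv (e (xi D α)) w p * (κ * h.form (D X) X) := fun X => by
    have h1 := hw.leftDeriv_curvature (fun _ _ => rfl) (e (incl D α X)) (e (xi D α))
      (e (incl D α X)) p
    have h2 : g.curvature (e (incl D α X)) (e (xi D α)) (e (incl D α X)) =
        e ((h.extend D α).curvature (incl D α X) (xi D α) (incl D α X)) := by
      simp only [curvature, hg, map_nabla_apply, ← LieEquiv.map_lie, ← map_sub]
    have h3 : (h.extend D α).curvature (incl D α X) (xi D α) (incl D α X) =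
        α • (incl D α (h.nabla (D X) X) + (α * h.form (D (D X)) X) • xi D α) := by
      simp only [curvature, extend_nabla hsol.form_symm, lie_def]
      ext <;> simp [incl, xi]
    have h5 : leftDeriv (e ((h.extend D α).curvature (incl D α X) (xi D α) (incl D α X))) w p =
        α * (W (h.nabla (D X) X) + α * h.form (D (D X)) X * leftDeriv (e (xi D α)) w p) := by
      rw [h3]
      change (leftDifferential (E := E) w p ∘ₗ
        (e.toLinearEquiv : LineExtension D α →ₗ[ℝ] _)) _ = _
      rw [map_smul, map_add, map_smul]
      rfl
    rw [h2, h5, hg, map_nabla_apply, map_nabla_apply, ← LieEquiv.map_lie, ← hg, hq, hq, hq, hq, hq,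
      extend_nabla hsol.form_symm, extend_nabla hsol.form_symm, lie_def] at h1
    generalize leftDeriv (e (xi D α)) w p = v at h1 ⊢
    simp [incl, xi] at h1
    linear_combination h1
  have hsum := Finset.sum_congr (rfl : (Finset.univ : Finset (Fin _)) = _) fun i _ => key (b i)
  have t1 : ∑ i, h.form (D (b i)) (b i) = T := (trace_eq_sum_form hb (D : 𝔥 →ₗ[ℝ] 𝔥)).symm
  have t2 : ∑ i, h.form (D (D (b i))) (b i) = -lam * T := by
    rw [hT, ← hsol.trace_sq]
    exact (trace_eq_sum_form hb ((D : 𝔥 →ₗ[ℝ] 𝔥) ∘ₗ (D : 𝔥 →ₗ[ℝ] 𝔥))).symm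
  -- After summation the terms in `w p` cancel, again by `tr D² = -lam tr D`.
  simp only [Finset.sum_add_distrib, ← Finset.mul_sum, ← Finset.sum_mul, ← map_sum,
    hsol.sum_nabla_eq_zero hb, t1, t2, Finset.sum_sub_distrib, Finset.sum_neg_distrib,
    map_zero, mul_zero, zero_add] at hsum
  linear_combination -hsum

theorem lt_trace_of_isQuasiEinstein [T2Space G] (hsol : h.IsAlgebraicRicciSoliton lam D)
    (hm : m ≠ 0) {w : G → ℝ}
    (hw : IsQuasiEinstein ((h.extend D α).map e.toLinearEquiv) m lam w)
    (hpos : D = 0 → ∀ p, 0 < w p)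
    (hne : ¬ ((h.extend D α).map e.toLinearEquiv).IsEinsteinWith lam) :
    m * lam < LinearMap.trace ℝ 𝔥 (D : 𝔥 →ₗ[ℝ] 𝔥) := by
  have hxi : ∀ p, leftDeriv (e (xi D α)) (leftDeriv (e (xi D α)) w) p =
      -((1 - α ^ 2 * LinearMap.trace ℝ 𝔥 (D : 𝔥 →ₗ[ℝ] 𝔥)) / m * lam) * w p := fun p => by
    have h0 : (h.extend D α).nabla (xi D α) (xi D α) = 0 := by
      rw [extend_nabla hsol.form_symm]
      simp [xi]
    rw [hw.leftDeriv_leftDeriv, hsol.map_extend_ricci e, map_nabla_apply, h0, map_zero]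
    have : leftDeriv (0 : GroupLieAlgebra 𝓘(ℝ, E) G) w p = 0 := map_zero (leftDifferential w p)
    rw [this]
    simp [xi]
    ring
  rw [map_isEinsteinWith_iff] at hne
  -- If `lam = 0` then `tr D² = 0`, so `D = 0` and the extension is Ricci-flat.
  have hlam : lam ≠ 0 := by
    rintro rfl
    have hD := hsol.eq_zero_of_trace_eq_zero (zero_mul _)
    refine hne fun x y => ?_
    have := hsol.extend_ricci α x y
    simpa [hD] using this
  by_cases hD : D = 0
  -- Only here is the positivity of `w` needed: a sign-changing sine would solve the equation along
  -- `ξ`.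
  · have hT : LinearMap.trace ℝ 𝔥 (D : 𝔥 →ₗ[ℝ] 𝔥) = 0 := by rw [hD]; exact map_zero _
    rw [hT] at hxi ⊢
    by_contra! hle
    have hc : 0 < m * lam := lt_of_le_of_ne hle (mul_ne_zero hm hlam).symm
    obtain ⟨γ, -, hγ⟩ := exists_integralCurve (e (xi D α)) (1 : G)
    refine not_forall_pos_of_hasDerivAt (c := lam / m) ?_
      (hasDerivAt_comp_integralCurve hγ (hw.smooth.mdifferentiable (by simp))) (fun t => ?_)
      fun t => hpos hD (γ t)
    · rw [← mul_div_mul_left lam m hm]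
      exact div_pos hc (mul_self_pos.2 hm)
    · have := hasDerivAt_comp_integralCurve hγ
        ((hw.contMDiff_leftDeriv (e (xi D α))).mdifferentiable two_ne_zero) t
      rw [hxi] at this
      convert this using 1
      ring
  · set T := LinearMap.trace ℝ 𝔥 (D : 𝔥 →ₗ[ℝ] 𝔥) with hT
    have hT0 : T ≠ 0 := fun h0 => hD (hsol.eq_zero_of_trace_eq_zero (by rw [← hT, h0, mul_zero]))
    have hκ0 : 1 - α ^ 2 * T ≠ 0 := fun h0 => hne fun x y => by
      have := hsol.extend_ricci α x y
      rw [← hT, h0, zero_mul] at this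
      linarith
    by_cases hκ : (1 - α ^ 2 * T) / m + lam * α ^ 2 = 0
    · have h1 : α ^ 2 * (T - m * lam) = 1 := by
        field_simp at hκ
        linear_combination -hκ
      by_contra! hle
      nlinarith [sq_nonneg α]
    · exfalso
      -- Now `ξw = 0` everywhere, hence `ξξw = 0`, and the `ξξ` equation with nonzero coefficient
      -- kills `w`.
      have h1 : leftDeriv (e (xi D α)) w = fun _ => 0 := funext fun p =>
        (mul_eq_zero.1 ((mul_eq_zero.1 (hsol.leftDeriv_xi_eq e hw p)).resolve_right
          hκ)).resolve_right hT0
      obtain ⟨p, hp⟩ := hw.nontrivial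
      have h2 := hxi p
      rw [h1, leftDeriv_const] at h2
      exact mul_ne_zero (neg_ne_zero.2 (mul_ne_zero (div_ne_zero hκ0 hm) hlam)) hp h2.symm

theorem exists_isQuasiEinstein [SimplyConnectedSpace G] (hsol : h.IsAlgebraicRicciSoliton lam D)
    (hm : m ≠ 0) (hα : α ^ 2 * (LinearMap.trace ℝ 𝔥 (D : 𝔥 →ₗ[ℝ] 𝔥) - m * lam) = 1) :
    ∃ w : G → ℝ, IsQuasiEinstein ((h.extend D α).map e.toLinearEquiv) m lam w ∧ ∀ p, 0 < w p := by
  have : T2Space (GroupLieAlgebra 𝓘(ℝ, E) G) := inferInstanceAs (T2Space E)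
  let θ : GroupLieAlgebra 𝓘(ℝ, E) G →L[ℝ] ℝ :=
    LinearMap.toContinuousLinearMap (projR D α ∘ₗ (e.toLinearEquiv.symm : _ →ₗ[ℝ] _))
  have hθe : ∀ x, θ (e x) = x.right := fun x =>
    congrArg (projR D α) (e.toLinearEquiv.symm_apply_apply x)
  have hθ : ∀ X Y : GroupLieAlgebra 𝓘(ℝ, E) G, θ ⁅X, Y⁆ = 0 := fun X Y => by
    obtain ⟨x, rfl⟩ : ∃ z, e z = X := e.surjective X
    obtain ⟨y, rfl⟩ : ∃ z, e z = Y := e.surjective Y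
    rw [← LieEquiv.map_lie, hθe]
    exact projR_lie D α x y
  obtain ⟨f, hf, hfX⟩ := exists_primitive θ hθ
  have hfd : MDifferentiable 𝓘(ℝ, E) 𝓘(ℝ, ℝ) f := hf.mdifferentiable (by simp)
  -- On `𝔥`, `Hess w = -c α ⟨D·,·⟩ w` must equal `-lam α² ⟨D·,·⟩ w`, which suggests this exponent;
  -- the `ξξ` entry `c² = lam² α²` then agrees.
  set c := lam * α with hc
  let w : G → ℝ := fun p => Real.exp (c * f p)
  have hu : ∀ t : ℝ, HasDerivAt (fun s => Real.exp (c * s)) (Real.exp (c * t) * c) t := fun t => by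
    have : HasDerivAt (fun s : ℝ => c * s) c t := by simpa using (hasDerivAt_id t).const_mul c
    exact this.exp
  have hw : ContMDiff 𝓘(ℝ, E) 𝓘(ℝ, ℝ) ∞ w :=
    ContMDiff.comp (g := fun s : ℝ => Real.exp (c * s))
      (Real.contDiff_exp.comp (contDiff_const.mul contDiff_id)).contMDiff hf
  have hw1 : ∀ X, leftDeriv X w = fun p => w p * (c * θ X) := fun X => funext fun p => by
    rw [leftDeriv_comp (hfd p) (hu (f p)), hfX, mul_assoc]
  refine ⟨w, ⟨hw, ⟨1, (Real.exp_pos _).ne'⟩, fun X Y p => ?_⟩, fun p => Real.exp_pos _⟩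
  obtain ⟨x, rfl⟩ : ∃ z, e z = X := e.surjective X
  obtain ⟨y, rfl⟩ : ∃ z, e z = Y := e.surjective Y
  have hκ : 1 - α ^ 2 * LinearMap.trace ℝ 𝔥 (D : 𝔥 →ₗ[ℝ] 𝔥) = -(m * lam * α ^ 2) := by
    linear_combination -hα
  rw [hessian, hw1 (e y), leftDeriv_mul_const (hw.mdifferentiable (by simp) p), map_nabla_apply,
    hw1, hw1, hθe, hθe, hθe, hsol.map_extend_ricci e, hκ, extend_nabla hsol.form_symm, hc]
  field_simp
  ring

/-- The `ξξ` entry of the deviation is `m lam² α²`. Its vanishing gives `lam = 0`, so `D = 0`,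
contradicting the strict inequality. -/
theorem not_isEinsteinWith_extend (hsol : h.IsAlgebraicRicciSoliton lam D)
    (hm : m ≠ 0) (hlt : m * lam < LinearMap.trace ℝ 𝔥 (D : 𝔥 →ₗ[ℝ] 𝔥))
    (hα : α ^ 2 * (LinearMap.trace ℝ 𝔥 (D : 𝔥 →ₗ[ℝ] 𝔥) - m * lam) = 1) :
    ¬ (h.extend D α).IsEinsteinWith lam := by
  intro hE
  have h1 := hsol.extend_ricci α (xi D α) (xi D α)
  rw [hE, sub_self] at h1
  have hκ : 1 - α ^ 2 * LinearMap.trace ℝ 𝔥 (D : 𝔥 →ₗ[ℝ] 𝔥) = -(m * lam * α ^ 2) := by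
    linear_combination -hα
  have hα0 : α ≠ 0 := by
    rintro rfl
    simp at hα
  have hlam : lam = 0 := by
    rw [hκ] at h1
    simpa [xi, hm, hα0] using h1
  have hD := hsol.eq_zero_of_trace_eq_zero (by rw [hlam, zero_mul])
  have hT : LinearMap.trace ℝ 𝔥 (D : 𝔥 →ₗ[ℝ] 𝔥) = 0 := by rw [hD]; exact map_zero _
  rw [hT, hlam, mul_zero] at hlt
  exact hlt.false

end InvariantMetric.IsAlgebraicRicciSoliton

end QuasiEinstein

end

/-! ### Assembly of the two equivalences. -/

theorem mainTheorem9
    {𝔥 : Type*} [LieRing 𝔥] [LieAlgebra ℝ 𝔥] [FiniteDimensional ℝ 𝔥]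
    (h : InvariantMetric 𝔥) (lam : ℝ) (D : LieDerivation ℝ 𝔥 𝔥)
    (hsol : h.IsAlgebraicRicciSoliton lam D)
    (m : ℝ) (hm : m ≠ 0)
    -- for each `α`, the simply connected Lie group `G α` with Lie algebra `ℝξ ⋉ 𝔥`, `ad ξ = α D`
    {E : Type*} [NormedAddCommGroup E] [NormedSpace ℝ E] [FiniteDimensional ℝ E]
    (G : ℝ → Type*) [∀ α, Group (G α)] [∀ α, TopologicalSpace (G α)]
    [∀ α, T2Space (G α)] [∀ α, SimplyConnectedSpace (G α)]
    [∀ α, ChartedSpace E (G α)] [∀ α, LieGroup 𝓘(ℝ, E) ∞ (G α)]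
    (e : ∀ α, LineExtension D α ≃ₗ⁅ℝ⁆ GroupLieAlgebra 𝓘(ℝ, E) (G α)) :
    (¬ h.IsEinsteinWith 0 →
      ((∃ (α : ℝ) (w : G α → ℝ),
          IsQuasiEinstein ((h.extend D α).map (e α).toLinearEquiv) m lam w ∧
          (D = 0 → ∀ p, 0 < w p) ∧
          ¬ ((h.extend D α).map (e α).toLinearEquiv).IsEinstein) ↔
        m * lam < LinearMap.trace ℝ 𝔥 (D : 𝔥 →ₗ[ℝ] 𝔥))) ∧
    ((∃ (α : ℝ) (w : G α → ℝ),
        IsQuasiEinstein ((h.extend D α).map (e α).toLinearEquiv) m lam w ∧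
        (D = 0 → ∀ p, 0 < w p) ∧
        ¬ ((h.extend D α).map (e α).toLinearEquiv).IsEinsteinWith lam) ↔
      m * lam < LinearMap.trace ℝ 𝔥 (D : 𝔥 →ₗ[ℝ] 𝔥)) := by
  have hnec : (∃ (α : ℝ) (w : G α → ℝ),
      IsQuasiEinstein ((h.extend D α).map (e α).toLinearEquiv) m lam w ∧
      (D = 0 → ∀ p, 0 < w p) ∧
      ¬ ((h.extend D α).map (e α).toLinearEquiv).IsEinsteinWith lam) →
      m * lam < LinearMap.trace ℝ 𝔥 (D : 𝔥 →ₗ[ℝ] 𝔥) := by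
    rintro ⟨α, w, hw, hpos, hne⟩
    exact hsol.lt_trace_of_isQuasiEinstein (e α) hm hw hpos hne
  have hsuf : m * lam < LinearMap.trace ℝ 𝔥 (D : 𝔥 →ₗ[ℝ] 𝔥) → ∃ (α : ℝ) (w : G α → ℝ),
      IsQuasiEinstein ((h.extend D α).map (e α).toLinearEquiv) m lam w ∧
      (D = 0 → ∀ p, 0 < w p) ∧ ¬ (h.extend D α).IsEinsteinWith lam := fun hlt => by
    obtain ⟨α, hα⟩ : ∃ α : ℝ,
        α ^ 2 * (LinearMap.trace ℝ 𝔥 (D : 𝔥 →ₗ[ℝ] 𝔥) - m * lam) = 1 := by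
      refine ⟨√(LinearMap.trace ℝ 𝔥 (D : 𝔥 →ₗ[ℝ] 𝔥) - m * lam)⁻¹, ?_⟩
      rw [Real.sq_sqrt (inv_nonneg.2 (sub_pos.2 hlt).le), inv_mul_cancel₀ (sub_pos.2 hlt).ne']
    obtain ⟨w, hw, hpos⟩ := hsol.exists_isQuasiEinstein (e α) hm hα
    exact ⟨α, w, hw, fun _ => hpos, hsol.not_isEinsteinWith_extend hm hlt hα⟩
  refine ⟨fun hric => ⟨?_, fun hlt => ?_⟩, hnec, fun hlt => ?_⟩
  · rintro ⟨α, w, hw, hpos, hne⟩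
    exact hnec ⟨α, w, hw, hpos, fun hE => hne ⟨lam, hE⟩⟩
  -- The same `α` and `w` serve both claims; `Ric_h ≠ 0` excludes the other Einstein constants.
  · obtain ⟨α, w, hw, hpos, hne⟩ := hsuf hlt
    refine ⟨α, w, hw, hpos, ?_⟩
    rintro ⟨mu, hmu⟩
    exact hsol.not_isEinstein_extend α hric hne ⟨mu, (InvariantMetric.map_isEinsteinWith_iff _ (e α) mu).1 hmu⟩
  · obtain ⟨α, w, hw, hpos, hne⟩ := hsuf hlt
    exact ⟨α, w, hw, hpos, fun hE => hne ((InvariantMetric.map_isEinsteinWith_iff _ (e α) lam).1 hE)⟩
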